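/- Let $\mathbb D\subset\mathbb C$ be the unit disk with its Poincaré metric $\frac{2|dz|}{1-|z|^2}$, and let $T^1\mathbb D$ be its unit tangent bundle, identified with $PSL(2,\mathbb R)$ by letting $g$ correspond to the image of the upward unit vector at $i$ in the upper half-plane under the derivative of $g$ followed by that of the Cayley transform $\tau\mapsto\frac{\tau-i}{\tau+i}$. The affine group $B=\left\{\begin{pmatrix}a&b\\0&a^{-1}\end{pmatrix}: a,b\in\mathbb R,\ a>0\right\}$ acts on $T^1\mathbb D\simeq PSL(2,\mathbb R)$ by right translation. Let $U\subset\mathbb D$ be an open disk, $T^1U$ its unit tangent bundle and $p:T^1U\to U$ the canonical projection. A (positive Borel) measure $\nu$ on $T^1U$ is called invariant under small elements of the affine group if for every continuous real-valued function $f$ with compact support in $T^1U$ (extended by $0$ to $T^1\mathbb D$) one has $\int f\,d\nu=\int (f\circ A)\,d\nu$ for all $A\in B$ sufficiently close to the identity. Let $\mu$ be a probability measure on $U$. Then there is at most one measure $\nu$ on $T^1U$ that is invariant under small elements of the affine group and satisfies $p_*\nu=\mu$. Moreover, identify $T^1U$ with $U\times S^1$ by letting $(z,\theta)$ correspond to the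 unit vector at $z$ pointing along the geodesic ray of $\mathbb D$ that ends at the point at infinity $\theta\in S^1$, and let $k(z,\theta)=\frac{1-|z|^2}{|\theta-z|^2}$ be the Poisson kernel and $dz$ the hyperbolic area. If such a $\nu$ exists, then there is a finite positive Borel measure $\varphi$ on $S^1$ such that $$\int F\,d\nu=\int_{S^1}\int_U F(z,\theta)\,k(z,\theta)\,dz\,d\varphi(\theta)$$ for every measurable $F:T^1U\to[0,\infty]$, and $\varphi$ is the only finite positive Borel measure on $S^1$ such that $\int G\,d\mu=\int_{S^1}\int_U G(z)\,k(z,\theta)\,dz\,d\varphi(\theta)$ for every measurable $G:U\to[0,\infty]$. -/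

import Mathlib

open MeasureTheory Filter Topology Complex
open scoped ENNReal MatrixGroups ComplexConjugate

namespace AffineLift

/-- The unit disk `𝔻` in `ℂ`, carrying the Poincaré metric `2 |dz| / (1 - |z|²)` (curvature `-1`). -/
def disk : Set ℂ := Metric.ball 0 1

lemma mem_disk {z : ℂ} : z ∈ disk ↔ ‖z‖ < 1 := by simp [disk]

/-- The unit tangent bundle `T¹U` of `U ⊆ 𝔻`: pairs (base point, tangent vector) such that the
tangent vector has length one, `2 ‖v‖ / (1 - ‖z‖²) = 1`, for the Poincaré metric. It carries the
topology and the Borel `σ`-algebra induced from `ℂ × ℂ`. -/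
def unitTangent (U : Set ℂ) : Set (ℂ × ℂ) := {ζ | ζ.1 ∈ U ∧ 2 * ‖ζ.2‖ = 1 - ‖ζ.1‖ ^ 2}

/-- The canonical projection `p : T¹U → U`. -/
def proj {U : Set ℂ} (ζ : unitTangent U) : U := ⟨ζ.1.1, ζ.2.1⟩

lemma unitTangent_mono {U : Set ℂ} (hU : U ⊆ disk) : unitTangent U ⊆ unitTangent disk :=
  fun _ h => ⟨hU h.1, h.2⟩

/-- The inclusion `T¹U ⊆ T¹𝔻`. -/
def incl {U : Set ℂ} (hU : U ⊆ disk) (ζ : unitTangent U) : unitTangent disk :=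
  Set.inclusion (unitTangent_mono hU) ζ

section Action

/-- Membership in the disk and unit length can be checked on one identity. -/
lemma mem_unitTangent_disk {w ξ : ℂ} (h : 2 * ‖ξ‖ = 1 - ‖w‖ ^ 2) (hξ : ξ ≠ 0) :
    (w, ξ) ∈ unitTangent disk := by
  refine ⟨?_, h⟩
  rw [mem_disk]
  have : 0 < ‖ξ‖ := norm_pos_iff.2 hξ
  nlinarith [norm_nonneg w]

lemma denom_ne_zero (g : SL(2, ℝ)) : (g 1 0 : ℂ) * I + g 1 1 ≠ 0 := by
  intro h
  have h1 := congrArg Complex.im h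
  have h2 := congrArg Complex.re h
  have h3 := g.det_coe
  simp at h1 h2
  rw [Matrix.det_fin_two] at h3
  simp [h1, h2] at h3

lemma cayley_denom_ne_zero (g : SL(2, ℝ)) :
    ((g 0 0 : ℂ) * I + g 0 1) / ((g 1 0 : ℂ) * I + g 1 1) + I ≠ 0 := by
  have hd := denom_ne_zero g
  intro h
  have h0 : ((g 0 0 : ℂ) * I + g 0 1) + I * ((g 1 0 : ℂ) * I + g 1 1) = 0 := by
    have h5 : (((g 0 0 : ℂ) * I + g 0 1) / ((g 1 0 : ℂ) * I + g 1 1) + I)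
        * ((g 1 0 : ℂ) * I + g 1 1) = 0 := by rw [h, zero_mul]
    rwa [add_mul, div_mul_cancel₀ _ hd] at h5
  have h1 := congrArg Complex.im h0
  have h2 := congrArg Complex.re h0
  have h3 := g.det_coe
  rw [Matrix.det_fin_two] at h3
  simp at h1 h2
  have e1 : g 1 1 = - g 0 0 := by linarith
  have e2 : g 1 0 = g 0 1 := by linarith
  rw [e1, e2] at h3
  nlinarith [sq_nonneg (g 0 0), sq_nonneg (g 0 1)]

lemma frame_mem (g : SL(2, ℝ)) :
    let δ : ℂ := (g 1 0 : ℂ) * I + g 1 1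
    let τ : ℂ := ((g 0 0 : ℂ) * I + g 0 1) / δ
    ((τ - I) / (τ + I), 2 * I / (τ + I) ^ 2 * (I / δ ^ 2)) ∈ unitTangent disk := by
  intro δ τ
  have hδ : δ ≠ 0 := denom_ne_zero g
  have hτ : τ + I ≠ 0 := cayley_denom_ne_zero g
  have him : τ.im * ‖δ‖ ^ 2 = 1 := by
    have h3 := g.det_coe
    rw [Matrix.det_fin_two] at h3
    have hn : normSq δ ≠ 0 := by simpa using hδ
    rw [← normSq_eq_norm_sq]
    simp only [τ, div_im]
    field_simp
    simp [δ]
    linear_combination h3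
  have key : ‖τ + I‖ ^ 2 - ‖τ - I‖ ^ 2 = 4 * τ.im := by
    rw [← normSq_eq_norm_sq, ← normSq_eq_norm_sq, normSq_apply, normSq_apply]
    simp
    ring
  apply mem_unitTangent_disk
  · have h1 : ‖τ + I‖ ≠ 0 := norm_ne_zero_iff.2 hτ
    have h2 : ‖δ‖ ≠ 0 := norm_ne_zero_iff.2 hδ
    simp only [norm_mul, norm_div, norm_pow, norm_I, Complex.norm_ofNat]
    field_simp
    linear_combination -4 * him - ‖δ‖ ^ 2 * key
  · simp [hδ, hτ]

/-- The identification of `PSL(2,ℝ)` with `T¹𝔻`: `g = (a b; c d)` goes to the image, under the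
derivative of `g` followed by the derivative of the Cayley transform `τ ↦ (τ - i) / (τ + i)`, of the
unit vector at `i` pointing upwards in the upper half-plane. Here `δ = c i + d`, `τ = g i`,
and the derivative of `g` at `i` is multiplication by `δ⁻²`. -/
noncomputable def frame (g : SL(2, ℝ)) : unitTangent disk :=
  ⟨_, frame_mem g⟩

lemma push_mem (ζ η : unitTangent disk) :
    let z : ℂ := ζ.1.1
    let u : ℂ := 2 * ζ.1.2 / (1 - ‖z‖ ^ 2 : ℝ)
    let w : ℂ := η.1.1
    ((u * w + z) / (1 + conj z * (u * w)),
      u * (1 - ‖z‖ ^ 2 : ℝ) / (1 + conj z * (u * w)) ^ 2 * η.1.2) ∈ unitTangent disk ∧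
    ‖u‖ = 1 ∧ 1 + conj z * (u * w) ≠ 0 := by
  intro z u w
  have hz : ‖z‖ < 1 := mem_disk.1 ζ.2.1
  have hw : ‖w‖ < 1 := mem_disk.1 η.2.1
  have hv : 2 * ‖ζ.1.2‖ = 1 - ‖z‖ ^ 2 := ζ.2.2
  have hx : 2 * ‖η.1.2‖ = 1 - ‖w‖ ^ 2 := η.2.2
  have hs : 0 < 1 - ‖z‖ ^ 2 := by nlinarith [norm_nonneg z]
  have ht : 0 < 1 - ‖w‖ ^ 2 := by nlinarith [norm_nonneg w]
  have hu : ‖u‖ = 1 := by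
    simp only [u, norm_div, norm_mul, Complex.norm_ofNat, Complex.norm_real, Real.norm_eq_abs,
      abs_of_pos hs, hv]
    exact div_self hs.ne'
  have hm : ‖u * w‖ = ‖w‖ := by rw [norm_mul, hu, one_mul]
  have key : ‖1 + conj z * (u * w)‖ ^ 2 - ‖u * w + z‖ ^ 2
      = (1 - ‖z‖ ^ 2) * (1 - ‖w‖ ^ 2) := by
    rw [← hm]
    simp only [← normSq_eq_norm_sq, normSq_apply]
    generalize u * w = m
    simp
    ring
  have hD : 1 + conj z * (u * w) ≠ 0 := by
    intro h
    rw [h] at key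
    have := mul_pos hs ht
    simp at key
    nlinarith [sq_nonneg ‖u * w + z‖]
  refine ⟨?_, hu, hD⟩
  have hD' : ‖1 + conj z * (u * w)‖ ≠ 0 := norm_ne_zero_iff.2 hD
  apply mem_unitTangent_disk
  · simp only [norm_mul, norm_div, norm_pow, hu, Complex.norm_real, Real.norm_eq_abs,
      abs_of_pos hs]
    generalize ‖1 + conj z * (u * w)‖ = D at hD' key ⊢
    rw [div_pow, one_mul]
    field_simp
    linear_combination (1 - ‖z‖ ^ 2) * hx - key
  · have h1 : u ≠ 0 := by rw [← norm_ne_zero_iff, hu]; exact one_ne_zero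
    have h2 : η.1.2 ≠ 0 := by rw [← norm_ne_zero_iff]; intro h; rw [h] at hx; linarith
    have h3 : ((1 - ‖z‖ ^ 2 : ℝ) : ℂ) ≠ 0 := by exact_mod_cast hs.ne'
    exact mul_ne_zero (div_ne_zero (mul_ne_zero h1 h3) (pow_ne_zero _ hD)) h2

/-- `push ζ η` is the image of `η ∈ T¹𝔻` under (the derivative of) the unique orientation preserving
isometry `ψ` of `𝔻` that carries the base vector `(0, 1/2)` to `ζ = (z, v)`; explicitly
`ψ w = (u w + z) / (1 + z̄ u w)` and `ψ' w = u (1 - |z|²) / (1 + z̄ u w)²`, with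
`u = 2 v / (1 - |z|²)`, a complex number of modulus one. -/
noncomputable def push (ζ η : unitTangent disk) : unitTangent disk :=
  ⟨_, (push_mem ζ η).1⟩

/-- The right action of `SL(2,ℝ)` (through `PSL(2,ℝ)`) on `T¹𝔻`: if `ζ` corresponds to `g`, then
`ζ · A` corresponds to `g A`; see `frame_surjective` and `rightAct_frame`. -/
noncomputable def rightAct (A : SL(2, ℝ)) (ζ : unitTangent disk) : unitTangent disk :=
  push ζ (frame A)

end Action

/-- The affine group `B`: the matrices `(a b; 0 a⁻¹)` with `a > 0`, under multiplication. -/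
def affineGroup : Subgroup SL(2, ℝ) where
  carrier := {A | A 1 0 = 0 ∧ 0 < A 0 0}
  one_mem' := by simp
  mul_mem' := by
    rintro A B ⟨hA, hA'⟩ ⟨hB, hB'⟩
    simp [Matrix.mul_apply, Fin.sum_univ_two, hA, hB, hA', hB']
  inv_mem' := by
    rintro A ⟨hA, hA'⟩
    have h := A.det_coe
    rw [Matrix.det_fin_two, hA, mul_zero, sub_zero] at h
    refine ⟨by simp [Matrix.SpecialLinearGroup.SL2_inv_expl, hA], ?_⟩
    have : 0 < A 1 1 := by
      by_contra h'
      nlinarith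
    simpa [Matrix.SpecialLinearGroup.SL2_inv_expl] using this

/-- Invariance of a measure `ν` on `T¹U` under small elements of the affine group: every continuous
`f` whose support is a compact subset of `T¹U` satisfies `∫ f dν = ∫ f ∘ A dν` for all `A` in a
neighbourhood (depending on `f`) of the identity of the affine group. -/
def InvariantSmall {U : Set ℂ} (hU : U ⊆ disk) (ν : Measure (unitTangent U)) : Prop :=
  ∀ f : unitTangent disk → ℝ, Continuous f → HasCompactSupport f →
    tsupport f ⊆ {ζ | ζ.1.1 ∈ U} →
    ∀ᶠ A : affineGroup in 𝓝 1,
      ∫ ζ, f (incl hU ζ) ∂ν = ∫ ζ, f (rightAct A (incl hU ζ)) ∂ν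

/-- Hyperbolic area on `U ⊆ 𝔻`. -/
noncomputable def area (U : Set ℂ) : Measure U :=
  (volume.withDensity fun z : ℂ => ENNReal.ofReal (4 / (1 - ‖z‖ ^ 2) ^ 2)).comap (↑)

/-- The circle `S¹` at infinity, with the topology and the Borel `σ`-algebra induced from `ℂ`. -/
def circle : Set ℂ := Metric.sphere 0 1

lemma toward_mem {z : ℂ} (hz : z ∈ disk) (θ : circle) :
    2 * ‖((1 - ‖z‖ ^ 2) / 2 : ℝ) * (((θ : ℂ) - z) / (1 - conj z * θ))‖ = 1 - ‖z‖ ^ 2 := by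
  have hz' : ‖z‖ < 1 := mem_disk.1 hz
  have hs : 0 < 1 - ‖z‖ ^ 2 := by nlinarith [norm_nonneg z]
  have hθ : ‖(θ : ℂ)‖ = 1 := mem_sphere_zero_iff_norm.1 θ.2
  have hne : (θ : ℂ) - z ≠ 0 := by
    intro h
    have : ‖z‖ = 1 := by rw [← sub_eq_zero.1 h, hθ]
    linarith
  have h : 1 - conj z * (θ : ℂ) = conj ((θ : ℂ) - z) * θ := by
    have : conj (θ : ℂ) * θ = 1 := by
      rw [mul_comm, Complex.mul_conj, normSq_eq_norm_sq, hθ]; simp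
    rw [map_sub, sub_mul, this]
  rw [h, norm_mul, norm_div, norm_mul, RCLike.norm_conj, hθ, mul_one,
    div_self (norm_ne_zero_iff.2 hne), Complex.norm_real, Real.norm_eq_abs, abs_of_pos (by linarith)]
  ring

/-- The identification `U × S¹ ≃ T¹U` in which the traces on `T¹U` of the orbits of the affine group
are the sets `U × {θ}`: the pair `(z, θ)` is the unit vector at `z` pointing along the geodesic
that ends at the point at infinity `θ`. -/
noncomputable def toward {U : Set ℂ} (hU : U ⊆ disk) (z : U) (θ : circle) : unitTangent U :=
  ⟨((z : ℂ), ((1 - ‖(z : ℂ)‖ ^ 2) / 2 : ℝ) * (((θ : ℂ) - z) / (1 - conj (z : ℂ) * θ))),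
    z.2, toward_mem (hU z.2) θ⟩

/-- The integral `∫_{S¹} ∫_U F(z, θ) k(z, θ) dz dφ(θ)` of a nonnegative function, where `k` is the
Poisson kernel `(1 - |z|²) / |θ - z|²` and `dz` is hyperbolic area. -/
noncomputable def poissonLIntegral {U : Set ℂ} (φ : Measure circle) (F : U → circle → ℝ≥0∞) : ℝ≥0∞ :=
  ∫⁻ θ, ∫⁻ z, F z θ * ENNReal.ofReal (poissonKernel 0 (z : ℂ) (θ : ℂ)) ∂(area U) ∂φ

section Check

/-- The numerator and the denominator of the base point of `frame g`. -/
noncomputable def num (g : SL(2, ℝ)) : ℂ := (g 0 1 + g 1 0 : ℝ) + (g 0 0 - g 1 1 : ℝ) * I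

/-- See `num`. -/
noncomputable def den (g : SL(2, ℝ)) : ℂ := (g 0 1 - g 1 0 : ℝ) + (g 0 0 + g 1 1 : ℝ) * I

lemma den_mul_conj (g : SL(2, ℝ)) : den g * conj (den g) = num g * conj (num g) + 4 := by
  have h := g.det_coe
  rw [Matrix.det_fin_two] at h
  have h' : (g 0 0 : ℂ) * g 1 1 - g 0 1 * g 1 0 = 1 := by exact_mod_cast h
  simp only [num, den, map_add, map_mul, conj_ofReal, conj_I]
  push_cast
  linear_combination 4 * h' - 4 * (g 0 0 * g 1 1 : ℂ) * I_sq

lemma den_ne_zero (g : SL(2, ℝ)) : den g ≠ 0 := by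
  intro h
  have h1 := den_mul_conj g
  rw [h, mul_conj] at h1
  have h2 := congrArg Complex.re h1
  simp at h2
  nlinarith [mul_self_nonneg (num g).re, mul_self_nonneg (num g).im]

lemma frame_eq (g : SL(2, ℝ)) : (frame g).1 = (num g / den g, -2 / den g ^ 2) := by
  have hδ := denom_ne_zero g
  have hq := den_ne_zero g
  have hp : ((g 0 0 : ℂ) * I + g 0 1) / ((g 1 0 : ℂ) * I + g 1 1) - I
      = num g / ((g 1 0 : ℂ) * I + g 1 1) := by
    rw [eq_div_iff hδ, sub_mul, div_mul_cancel₀ _ hδ]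
    simp only [num]
    push_cast
    linear_combination -(g 1 0 : ℂ) * I_sq
  have hq' : ((g 0 0 : ℂ) * I + g 0 1) / ((g 1 0 : ℂ) * I + g 1 1) + I
      = den g / ((g 1 0 : ℂ) * I + g 1 1) := by
    rw [eq_div_iff hδ, add_mul, div_mul_cancel₀ _ hδ]
    simp only [den]
    push_cast
    linear_combination (g 1 0 : ℂ) * I_sq
  simp only [frame, hp, hq', Prod.mk.injEq]
  constructor
  · field_simp
  · generalize (g 1 0 : ℂ) * I + g 1 1 = δ at hδ ⊢
    field_simp
    linear_combination I_sq

lemma frame_surjective : Function.Surjective frame := by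
  rintro ⟨⟨z, v⟩, hz, hv⟩
  simp only at hz hv
  have hz' : ‖z‖ < 1 := mem_disk.1 hz
  have hs : 0 < 1 - ‖z‖ ^ 2 := by nlinarith [norm_nonneg z]
  have hv0 : v ≠ 0 := by rw [← norm_ne_zero_iff]; intro h; rw [h] at hv; linarith
  obtain ⟨q, hq⟩ := IsAlgClosed.exists_pow_nat_eq (-2 / v) (n := 2) two_pos
  have hq0 : q ≠ 0 := by
    rintro rfl
    rw [zero_pow two_ne_zero] at hq
    exact div_ne_zero (by norm_num) hv0 hq.symm
  have hqn : ‖q‖ ^ 2 - ‖z * q‖ ^ 2 = 4 := by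
    have h1 : ‖q‖ ^ 2 * ‖v‖ = 2 := by
      rw [← norm_pow, hq, norm_div, div_mul_cancel₀ _ (norm_ne_zero_iff.2 hv0)]
      simp
    rw [norm_mul]
    linear_combination 2 * h1 - ‖q‖ ^ 2 * hv
  rw [← normSq_eq_norm_sq, ← normSq_eq_norm_sq, normSq_apply, normSq_apply] at hqn
  generalize hp : z * q = p at hqn
  have hdet : Matrix.det !![(q.im + p.im) / 2, (q.re + p.re) / 2; (p.re - q.re) / 2,
      (q.im - p.im) / 2] = 1 := by
    rw [Matrix.det_fin_two_of]
    linear_combination hqn / 4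
  let g : SL(2, ℝ) := ⟨_, hdet⟩
  have hn : num g = p := by
    apply Complex.ext <;> simp [num, g] <;> ring
  have hd : den g = q := by
    apply Complex.ext <;> simp [den, g] <;> ring
  refine ⟨g, Subtype.ext ?_⟩
  rw [frame_eq, hn, hd, hq, ← hp]
  simp [hq0]

lemma rightAct_frame (A g : SL(2, ℝ)) : rightAct A (frame g) = frame (g * A) := by
  have hq := den_ne_zero g
  have hQ := den_ne_zero A
  have hq' := den_ne_zero (g * A)
  have hcq : conj (den g) ≠ 0 := (map_ne_zero _).2 hq
  have e1 : 2 * I * den (g * A) = den g * den A - conj (num g) * num A := by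
    simp only [num, den, map_add, map_mul, conj_ofReal, conj_I, Matrix.SpecialLinearGroup.coe_mul,
      Matrix.mul_apply, Fin.sum_univ_two]
    push_cast
    ring_nf
    simp only [I_sq]
    ring
  have e2 : 2 * I * num (g * A) = num g * den A - conj (den g) * num A := by
    simp only [num, den, map_add, map_mul, conj_ofReal, conj_I, Matrix.SpecialLinearGroup.coe_mul,
      Matrix.mul_apply, Fin.sum_univ_two]
    push_cast
    ring_nf
    simp only [I_sq]
    ring
  have hs : ((1 - ‖num g / den g‖ ^ 2 : ℝ) : ℂ) = 4 / (den g * conj (den g)) := by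
    push_cast
    rw [← conj_mul', map_div₀, eq_div_iff (mul_ne_zero hq hcq)]
    field_simp
    linear_combination den_mul_conj g
  have hu : 2 * (-2 / den g ^ 2) / (4 / (den g * conj (den g))) = - conj (den g) / den g := by
    field_simp
    norm_num
  have hD : 1 + conj (num g / den g) * (- conj (den g) / den g * (num A / den A))
      = 2 * I * den (g * A) / (den g * den A) := by
    rw [e1, map_div₀]
    field_simp
    ring
  have hN : - conj (den g) / den g * (num A / den A) + num g / den g
      = 2 * I * num (g * A) / (den g * den A) := by
    rw [e2]
    field_simp
    ring
  apply Subtype.ext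
  simp only [rightAct, push, frame_eq, hs, hu, hD, hN, Prod.mk.injEq]
  constructor
  · field_simp
  · field_simp
    rw [I_sq]
    norm_num

end Check

end AffineLift

namespace AffineLift

/-! ### Horocyclic coordinates on the unit tangent bundle -/

/-! Send the end point `θ` of a unit vector to infinity by an inverse Cayley transform, and write
its base point as `x + i e^t`. In the coordinates `(x, t, θ)` (`horoCoords`) the affine group fixes
`θ` and acts by `(x, t) ↦ (x + e^t x', t + t')` (`rightAct_orbitPt`). This preserves `dx dt`, and
`k(z, θ) dz` becomes exactly `dx dt` (`lintegral_cayley_hpt`). So the claimed form of `ν` says that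
`ν` is a superposition of these orbit measures.

Existence of `φ`. For each `θ` the trace of `U` on the orbit is convex in the half-plane coordinate
(`fst_orbitPt_mem_ball`). Small translations can therefore be chained along straight segments,
giving `∫ f(ζA) h(ζ) dν = ∫ f(ζ) h(ζA⁻¹) dν` for every `A` in the affine group and all `f`, `h` with
compact support in `T¹U` (`integral_rightAct_mul`). Integrating over the group yields the symmetry
`∫ f · O(h) dν = ∫ h · O(f) dν`, where `O` denotes integration over the orbit
(`lintegral_mul_orbitLIntegral_comm`). With `h` a fixed bump function, `O(h)` is a function of `θ`
bounded above and away from zero. Dividing by it identifies `ν` (`exists_measure_circle`).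

Uniqueness of `φ`. The density of `μ` with respect to area is the Poisson integral of `φ`. It is
continuous, so `μ` determines it at every point of `U`. It is an affine function of the real part of
a power series on `𝔻` whose coefficients are the moments of `φ`. The open mapping and identity
theorems recover the moments from `U` (`circle_measure_eq_of_integral_poissonKernel`), and
trigonometric polynomials recover `φ` (`circle_measure_ext`). Since `φ` determines `ν`, the lift is
unique too. -/

lemma norm_circle (θ : circle) : ‖(θ : ℂ)‖ = 1 := mem_sphere_zero_iff_norm.1 θ.2

lemma circle_ne_zero (θ : circle) : (θ : ℂ) ≠ 0 := by
  rw [← norm_ne_zero_iff, norm_circle]; exact one_ne_zero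

lemma circle_mul_conj (θ : circle) : (θ : ℂ) * conj (θ : ℂ) = 1 := by
  rw [Complex.mul_conj, normSq_eq_norm_sq, norm_circle]; simp

lemma circle_sub_ne_zero {z : ℂ} (hz : z ∈ disk) (θ : circle) : (θ : ℂ) - z ≠ 0 := by
  intro h
  have h1 := norm_circle θ
  rw [sub_eq_zero.1 h] at h1
  exact (mem_disk.1 hz).ne h1

/-- The element of the affine group which acts on the upper half-plane by `τ ↦ e ^ t τ + x`. -/
noncomputable def affineMat (x t : ℝ) : SL(2, ℝ) :=
  ⟨!![Real.exp (t / 2), x * Real.exp (-t / 2); 0, Real.exp (-t / 2)], by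
    rw [Matrix.det_fin_two_of, mul_zero, sub_zero, ← Real.exp_add]
    simp [neg_div]⟩

@[simp] lemma affineMat_zero_zero (x t : ℝ) : affineMat x t 0 0 = Real.exp (t / 2) := rfl
@[simp] lemma affineMat_zero_one (x t : ℝ) : affineMat x t 0 1 = x * Real.exp (-t / 2) := rfl
@[simp] lemma affineMat_one_zero (x t : ℝ) : affineMat x t 1 0 = 0 := rfl
@[simp] lemma affineMat_one_one (x t : ℝ) : affineMat x t 1 1 = Real.exp (-t / 2) := rfl

lemma affineMat_mul (x t x' t' : ℝ) :
    affineMat x t * affineMat x' t' = affineMat (x + Real.exp t * x') (t + t') := by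
  have h : Real.exp (t / 2) = Real.exp t * Real.exp (-t / 2) := by
    rw [← Real.exp_add]; congr 1; ring
  have h2 : Real.exp ((-t' + -t) / 2) = Real.exp (-t / 2) * Real.exp (-t' / 2) := by
    rw [← Real.exp_add]; congr 1; ring
  have h3 : Real.exp ((t + t') / 2) = Real.exp (t / 2) * Real.exp (t' / 2) := by
    rw [← Real.exp_add]; congr 1; ring
  apply Subtype.ext
  ext i j
  rw [Matrix.SpecialLinearGroup.coe_mul, Matrix.mul_apply, Fin.sum_univ_two]
  fin_cases i <;> fin_cases j <;> simp [h2, h3]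
  rw [h]; ring

/-- `affineMat` as an element of the affine group. -/
noncomputable def aff (x t : ℝ) : affineGroup :=
  ⟨affineMat x t, by simp [affineMat], by simp [affineMat, Real.exp_pos]⟩

lemma aff_zero : aff 0 0 = 1 := by
  apply Subtype.ext
  apply Subtype.ext
  ext i j
  fin_cases i <;> fin_cases j <;> simp [aff, affineMat]

lemma continuous_aff : Continuous fun p : ℝ × ℝ => aff p.1 p.2 := by
  refine Continuous.subtype_mk (Continuous.subtype_mk ?_ _) _
  refine continuous_matrix fun i j => ?_
  fin_cases i <;> fin_cases j <;> simp <;> fun_prop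

/-- The rotation `τ ↦ (κ₁ τ + κ₂) / (-κ₂ τ + κ₁)` around `i`. -/
noncomputable def rot (κ : ℂ) (hκ : ‖κ‖ = 1) : SL(2, ℝ) :=
  ⟨!![κ.re, κ.im; -κ.im, κ.re], by
    have : ‖κ‖ ^ 2 = 1 := by rw [hκ, one_pow]
    rw [← normSq_eq_norm_sq, normSq_apply] at this
    rw [Matrix.det_fin_two_of]
    linarith⟩

lemma coe_rot (κ : ℂ) (hκ : ‖κ‖ = 1) :
    (rot κ hκ : Matrix (Fin 2) (Fin 2) ℝ) = !![κ.re, κ.im; -κ.im, κ.re] := rfl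

/-- The Cayley transform diagonalizes the rotations around `i`. As `den` is multiplied by the
conjugate of `κ`, base points in the disk turn by `κ ^ 2`; reaching a given `θ` thus requires a
square root of `θ`. -/
lemma num_rot_mul (κ : ℂ) (hκ : ‖κ‖ = 1) (g : SL(2, ℝ)) : num (rot κ hκ * g) = κ * num g := by
  apply Complex.ext <;>
    simp [num, coe_rot, Matrix.SpecialLinearGroup.coe_mul, Matrix.mul_apply,
      Fin.sum_univ_two] <;> ring

lemma den_rot_mul (κ : ℂ) (hκ : ‖κ‖ = 1) (g : SL(2, ℝ)) :
    den (rot κ hκ * g) = conj κ * den g := by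
  apply Complex.ext <;>
    simp [den, coe_rot, Matrix.SpecialLinearGroup.coe_mul, Matrix.mul_apply,
      Fin.sum_univ_two] <;> ring

/-- The point of the upper half-plane with horocyclic coordinates `(x, t)`. -/
noncomputable def hpt (x t : ℝ) : ℂ := x + (Real.exp t : ℂ) * I

@[simp] lemma hpt_re (x t : ℝ) : (hpt x t).re = x := by
  simp only [hpt, add_re, ofReal_re, mul_re, I_re, I_im, ofReal_im]; ring
@[simp] lemma hpt_im (x t : ℝ) : (hpt x t).im = Real.exp t := by
  simp only [hpt, add_im, ofReal_re, mul_im, I_re, I_im, ofReal_im]; ring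

lemma add_I_ne_zero {w : ℂ} (hw : 0 < w.im) : w + I ≠ 0 := by
  intro h
  have := congrArg Complex.im h
  simp at this
  linarith

lemma hpt_add_I_ne_zero (x t : ℝ) : hpt x t + I ≠ 0 := add_I_ne_zero (by simp [Real.exp_pos])

lemma one_sub_norm_cayley_sq {w : ℂ} (hw : 0 < w.im) (θ : circle) :
    1 - ‖(θ : ℂ) * ((w - I) / (w + I))‖ ^ 2 = 4 * w.im / ‖w + I‖ ^ 2 := by
  have h := norm_ne_zero_iff.2 (add_I_ne_zero hw)
  rw [norm_mul, norm_circle, one_mul, norm_div, div_pow]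
  field_simp
  rw [← normSq_eq_norm_sq, ← normSq_eq_norm_sq, normSq_apply, normSq_apply]
  simp
  ring

lemma cayley_mem_disk {w : ℂ} (hw : 0 < w.im) (θ : circle) :
    (θ : ℂ) * ((w - I) / (w + I)) ∈ disk := by
  have h := one_sub_norm_cayley_sq hw θ
  have h1 := norm_pos_iff.2 (add_I_ne_zero hw)
  have h2 : 0 < 4 * w.im / ‖w + I‖ ^ 2 := by positivity
  rw [mem_disk]
  nlinarith [norm_nonneg ((θ : ℂ) * ((w - I) / (w + I)))]

/-- The level sets of `k(·, θ)` are the horocycles at `θ`, which become horizontal lines when `θ` is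
sent to infinity. Hence the coordinate `t` is the logarithm of the Poisson kernel. -/
lemma poissonKernel_cayley {w : ℂ} (hw : 0 < w.im) (θ : circle) :
    poissonKernel 0 ((θ : ℂ) * ((w - I) / (w + I))) θ = w.im := by
  have h := norm_ne_zero_iff.2 (add_I_ne_zero hw)
  have h1 : (θ : ℂ) - θ * ((w - I) / (w + I)) = θ * (2 * I / (w + I)) := by
    field_simp [add_I_ne_zero hw]
    ring
  rw [poissonKernel, sub_zero, sub_zero, norm_circle, one_pow, one_sub_norm_cayley_sq hw, h1]
  simp only [norm_mul, norm_circle, norm_div, Complex.norm_ofNat, norm_I]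
  field_simp
  norm_num

/-- The unit vector with horocyclic coordinates `(x, t)` pointing to the point `θ` at infinity. -/
noncomputable def orbitPt (x t : ℝ) (θ : circle) : unitTangent disk :=
  toward Set.Subset.rfl ⟨(θ : ℂ) * ((hpt x t - I) / (hpt x t + I)),
    cayley_mem_disk (by simp [Real.exp_pos]) θ⟩ θ

lemma orbitPt_fst (x t : ℝ) (θ : circle) :
    (orbitPt x t θ).1.1 = (θ : ℂ) * ((hpt x t - I) / (hpt x t + I)) := rfl

lemma num_affineMat (x t : ℝ) : num (affineMat x t) = Real.exp (-t / 2) * (hpt x t - I) := by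
  have h : Real.exp (t / 2) = Real.exp t * Real.exp (-t / 2) := by
    rw [← Real.exp_add]; congr 1; ring
  simp only [num, affineMat, hpt]
  simp [h, -ofReal_exp]
  ring

lemma den_affineMat (x t : ℝ) : den (affineMat x t) = Real.exp (-t / 2) * (hpt x t + I) := by
  have h : Real.exp (t / 2) = Real.exp t * Real.exp (-t / 2) := by
    rw [← Real.exp_add]; congr 1; ring
  simp only [den, affineMat, hpt]
  simp [h, -ofReal_exp]
  ring

lemma frame_rot_mul_affineMat (x t : ℝ) (κ : ℂ) (hκ : ‖κ‖ = 1) (θ : circle)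
    (h : κ ^ 2 = θ) : frame (rot κ hκ * affineMat x t) = orbitPt x t θ := by
  have hκ0 : κ ≠ 0 := by rw [← norm_ne_zero_iff, hκ]; exact one_ne_zero
  have hc : conj κ = κ⁻¹ := (Complex.inv_eq_conj hκ).symm
  have he : ((Real.exp (-t / 2) : ℝ) : ℂ) ≠ 0 := by exact_mod_cast (Real.exp_pos _).ne'
  have hd := hpt_add_I_ne_zero x t
  have hcd : conj (hpt x t) - I ≠ 0 := by
    have := (map_ne_zero (starRingEnd ℂ)).2 hd
    simpa [sub_eq_add_neg] using this
  have hz := one_sub_norm_cayley_sq (w := hpt x t) (by simp [Real.exp_pos]) θ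
  have hee : ((Real.exp t : ℝ) : ℂ) * ((Real.exp (-t / 2) : ℝ) : ℂ) ^ 2 = 1 := by
    norm_cast
    rw [pow_two, ← Real.exp_add, ← Real.exp_add]
    simp
  have hθc : conj (θ : ℂ) = (θ : ℂ)⁻¹ := (Complex.inv_eq_conj (norm_circle θ)).symm
  have hθ0 := circle_ne_zero θ
  apply Subtype.ext
  rw [frame_eq, num_rot_mul, den_rot_mul, num_affineMat, den_affineMat, hc]
  simp only [orbitPt, toward, Prod.mk.injEq, hz]
  constructor
  · rw [← h]
    field_simp
  · have h1 : ((4 * (hpt x t).im / ‖hpt x t + I‖ ^ 2 / 2 : ℝ) : ℂ)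
        = 2 * Real.exp t / ((hpt x t + I) * (conj (hpt x t) - I)) := by
      have : (hpt x t + I) * (conj (hpt x t) - I) = ((‖hpt x t + I‖ ^ 2 : ℝ) : ℂ) := by
        rw [← normSq_eq_norm_sq, ← Complex.mul_conj]
        simp [sub_eq_add_neg]
      rw [this, hpt_im]
      push_cast
      ring
    have h2 : (θ : ℂ) - θ * ((hpt x t - I) / (hpt x t + I)) = θ * (2 * I) / (hpt x t + I) := by
      field_simp
      ring
    have h3 : 1 - conj ((θ : ℂ) * ((hpt x t - I) / (hpt x t + I))) * θ
        = -2 * I / (conj (hpt x t) - I) := by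
      simp only [map_mul, map_div₀, map_sub, map_add, conj_I, hθc, sub_neg_eq_add,
        ← sub_eq_add_neg]
      field_simp
      ring
    rw [h1, h2, h3, ← h]
    generalize ((Real.exp (-t / 2) : ℝ) : ℂ) = e at he hee ⊢
    field_simp
    linear_combination hee

/-- Every point of the orbit comes from a product of one fixed rotation with an affine matrix, so
the right action is multiplication within the affine group. -/
lemma rightAct_orbitPt (x t x' t' : ℝ) (θ : circle) :
    rightAct (affineMat x' t') (orbitPt x t θ) =
      orbitPt (x + Real.exp t * x') (t + t') θ := by
  obtain ⟨κ, h⟩ := IsAlgClosed.exists_pow_nat_eq (θ : ℂ) (n := 2) two_pos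
  have hκ : ‖κ‖ = 1 := by
    have h1 : ‖κ‖ ^ 2 = 1 := by rw [← norm_pow, h, norm_circle]
    exact (pow_eq_one_iff_of_nonneg (norm_nonneg _) two_ne_zero).1 h1
  rw [← frame_rot_mul_affineMat x t κ hκ θ h, rightAct_frame, mul_assoc, affineMat_mul,
    frame_rot_mul_affineMat _ _ κ hκ θ h]

/-! ### End points at infinity and the inverse of the coordinates. -/

lemma norm_sq_lt_one {z : ℂ} (hz : z ∈ disk) : 0 < 1 - ‖z‖ ^ 2 := by
  have := mem_disk.1 hz
  nlinarith [norm_nonneg z]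

/-- The isometry `w ↦ (u w + z) / (1 + z̄ u w)` carries the vector `(0, 1/2)` to `ζ`. The ray along
that vector ends at `1`, so the ray along `ζ` ends at `(u + z) / (1 + z̄ u)`. The last identity
shows that this quotient has modulus one. -/
lemma endpoint_aux (ζ : unitTangent disk) :
    let u : ℂ := 2 * ζ.1.2 / (1 - ‖ζ.1.1‖ ^ 2 : ℝ)
    u * conj u = 1 ∧ u + ζ.1.1 ≠ 0 ∧ 1 + conj ζ.1.1 * u = u * conj (u + ζ.1.1) := by
  intro u
  have hs := norm_sq_lt_one ζ.2.1
  have hu : ‖u‖ = 1 := by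
    simp only [u, norm_div, norm_mul, Complex.norm_ofNat, Complex.norm_real, Real.norm_eq_abs,
      abs_of_pos hs, ζ.2.2]
    exact div_self hs.ne'
  have h1 : u * conj u = 1 := by
    rw [Complex.mul_conj, normSq_eq_norm_sq, hu]; simp
  refine ⟨h1, fun h => ?_, ?_⟩
  · have h2 : ‖ζ.1.1‖ < 1 := mem_disk.1 ζ.2.1
    rw [eq_neg_of_add_eq_zero_left h, norm_neg] at hu
    exact h2.ne hu
  · rw [map_add, mul_add, h1]; ring

/-- The point at infinity at which the geodesic ray spanned by a unit vector ends. -/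
noncomputable def endpoint (ζ : unitTangent disk) : circle :=
  ⟨(2 * ζ.1.2 / (1 - ‖ζ.1.1‖ ^ 2 : ℝ) + ζ.1.1) /
      (1 + conj ζ.1.1 * (2 * ζ.1.2 / (1 - ‖ζ.1.1‖ ^ 2 : ℝ))), by
    obtain ⟨h1, h2, h3⟩ := endpoint_aux ζ
    have h4 := congrArg norm h1
    simp only [norm_mul, RCLike.norm_conj, norm_one] at h4
    have h5 := (mul_self_eq_one_iff.1 h4).resolve_right
      fun h => by linarith [norm_nonneg (2 * ζ.1.2 / (1 - ‖ζ.1.1‖ ^ 2 : ℝ))]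
    rw [circle, mem_sphere_zero_iff_norm, h3, norm_div, norm_mul, RCLike.norm_conj, h5, one_mul]
    exact div_self (norm_ne_zero_iff.2 h2)⟩

lemma toward_endpoint (ζ : unitTangent disk) :
    toward Set.Subset.rfl ⟨ζ.1.1, ζ.2.1⟩ (endpoint ζ) = ζ := by
  obtain ⟨h1, h2, h3⟩ := endpoint_aux ζ
  have hs := norm_sq_lt_one ζ.2.1
  apply Subtype.ext
  apply Prod.ext
  · rfl
  simp only [toward, endpoint]
  have hs0 : ((1 - ‖ζ.1.1‖ ^ 2 : ℝ) : ℂ) ≠ 0 := by exact_mod_cast hs.ne'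
  have hu : ζ.1.2 = ((1 - ‖ζ.1.1‖ ^ 2 : ℝ) : ℂ) / 2 * (2 * ζ.1.2 / (1 - ‖ζ.1.1‖ ^ 2 : ℝ)) := by
    field_simp
  have hn : ((1 - ‖ζ.1.1‖ ^ 2 : ℝ) : ℂ) = 1 - conj ζ.1.1 * ζ.1.1 := by
    rw [Complex.conj_mul']; push_cast; rfl
  conv_rhs => rw [hu]
  generalize 2 * ζ.1.2 / ((1 - ‖ζ.1.1‖ ^ 2 : ℝ) : ℂ) = u at h1 h2 h3 ⊢
  have hu0 : u ≠ 0 := left_ne_zero_of_mul_eq_one h1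
  have hD : 1 + conj ζ.1.1 * u ≠ 0 := by
    rw [h3]; exact mul_ne_zero hu0 ((map_ne_zero _).2 h2)
  have e1 : (u + ζ.1.1) / (1 + conj ζ.1.1 * u) - ζ.1.1
      = u * ((1 - ‖ζ.1.1‖ ^ 2 : ℝ) : ℂ) / (1 + conj ζ.1.1 * u) := by
    rw [hn, div_sub' hD]; congr 1; ring
  have e2 : 1 - conj ζ.1.1 * ((u + ζ.1.1) / (1 + conj ζ.1.1 * u))
      = ((1 - ‖ζ.1.1‖ ^ 2 : ℝ) : ℂ) / (1 + conj ζ.1.1 * u) := by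
    rw [hn]; field_simp; ring
  rw [e1, e2, div_div_div_cancel_right₀ hD, mul_div_cancel_right₀ _ hs0]
  push_cast
  rfl

lemma toward_injective {U : Set ℂ} (hU : U ⊆ disk) (z : U) :
    Function.Injective (toward hU z) := by
  intro θ θ' h
  have hz := norm_sq_lt_one (hU z.2)
  have h1 := congrArg (fun ζ : unitTangent U => ζ.1.2) h
  simp only [toward] at h1
  have h2 : (((1 - ‖(z : ℂ)‖ ^ 2) / 2 : ℝ) : ℂ) ≠ 0 := by
    exact_mod_cast (half_pos hz).ne'
  have hd : ∀ η : circle, 1 - conj (z : ℂ) * η ≠ 0 := by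
    intro η h
    have h3 := congrArg norm (sub_eq_zero.1 h)
    rw [norm_one, norm_mul, norm_circle, RCLike.norm_conj, mul_one] at h3
    exact (mem_disk.1 (hU z.2)).ne h3.symm
  have h3 := mul_left_cancel₀ h2 h1
  rw [div_eq_div_iff (hd θ) (hd θ')] at h3
  have hn : ((1 - ‖(z : ℂ)‖ ^ 2 : ℝ) : ℂ) = 1 - conj (z : ℂ) * z := by
    rw [Complex.conj_mul']; push_cast; rfl
  have hn0 : 1 - conj (z : ℂ) * z ≠ 0 := by rw [← hn]; exact_mod_cast hz.ne'
  apply Subtype.ext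
  apply mul_right_cancel₀ hn0
  linear_combination h3

lemma endpoint_toward (z : disk) (θ : circle) :
    endpoint (toward Set.Subset.rfl z θ) = θ :=
  toward_injective Set.Subset.rfl z (toward_endpoint (toward Set.Subset.rfl z θ))

lemma continuous_endpoint : Continuous endpoint := by
  have hs : ∀ ζ : unitTangent disk, ((1 - ‖ζ.1.1‖ ^ 2 : ℝ) : ℂ) ≠ 0 := fun ζ => by
    exact_mod_cast (norm_sq_lt_one ζ.2.1).ne'
  refine Continuous.subtype_mk ?_ _
  refine Continuous.div ?_ ?_ fun ζ => ?_
  · exact (Continuous.div (by fun_prop) (by fun_prop) hs).add (by fun_prop)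
  · exact continuous_const.add ((by fun_prop : Continuous fun ζ : unitTangent disk =>
      conj ζ.1.1).mul (Continuous.div (by fun_prop) (by fun_prop) hs))
  · obtain ⟨h1, h2, h3⟩ := endpoint_aux ζ
    rw [h3]
    exact mul_ne_zero (left_ne_zero_of_mul_eq_one h1) ((map_ne_zero _).2 h2)

lemma poissonKernel_pos {z : ℂ} (hz : z ∈ disk) (θ : circle) : 0 < poissonKernel 0 z θ := by
  have h := norm_pos_iff.2 (circle_sub_ne_zero hz θ)
  rw [poissonKernel, sub_zero, sub_zero, norm_circle, one_pow]
  exact div_pos (norm_sq_lt_one hz) (by positivity)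

/-- The inverse Cayley transform which takes `θ` to infinity. -/
noncomputable def cayleyInv (z : ℂ) (θ : circle) : ℂ := I * ((θ + z) / (θ - z))

lemma cayleyInv_im (z : ℂ) (θ : circle) : (cayleyInv z θ).im = poissonKernel 0 z θ := by
  rw [poissonKernel_eq_re_herglotzRieszKernel, cayleyInv, I_mul_im]
  simp [herglotzRieszKernel]

lemma cayley_cayleyInv {z : ℂ} (hz : z ∈ disk) (θ : circle) :
    (θ : ℂ) * ((cayleyInv z θ - I) / (cayleyInv z θ + I)) = z := by
  have h := circle_sub_ne_zero hz θ
  have hθ := circle_ne_zero θ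
  have e1 : cayleyInv z θ - I = 2 * I * z / (θ - z) := by
    rw [cayleyInv]; field_simp; ring
  have e2 : cayleyInv z θ + I = 2 * I * θ / (θ - z) := by
    rw [cayleyInv]; field_simp; ring
  rw [e1, e2]
  field_simp

lemma cayleyInv_cayley {w : ℂ} (hw : 0 < w.im) (θ : circle) :
    cayleyInv ((θ : ℂ) * ((w - I) / (w + I))) θ = w := by
  have h := add_I_ne_zero hw
  have hθ := circle_ne_zero θ
  have e1 : (θ : ℂ) + θ * ((w - I) / (w + I)) = θ * (2 * w) / (w + I) := by
    field_simp; ring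
  have e2 : (θ : ℂ) - θ * ((w - I) / (w + I)) = θ * (2 * I) / (w + I) := by
    field_simp; ring
  rw [cayleyInv, e1, e2]
  field_simp

/-- The first horocyclic coordinate of a unit vector. -/
noncomputable def abscissa (ζ : unitTangent disk) : ℝ := (cayleyInv ζ.1.1 (endpoint ζ)).re

/-- The height of a unit vector above the horocycles at its end point. -/
noncomputable def height (ζ : unitTangent disk) : ℝ :=
  Real.log (poissonKernel 0 ζ.1.1 (endpoint ζ))

lemma exp_height (ζ : unitTangent disk) :
    Real.exp (height ζ) = poissonKernel 0 ζ.1.1 (endpoint ζ) :=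
  Real.exp_log (poissonKernel_pos ζ.2.1 _)

lemma continuous_cayleyInv_endpoint :
    Continuous fun ζ : unitTangent disk => cayleyInv ζ.1.1 (endpoint ζ) := by
  have h : Continuous fun ζ => (endpoint ζ : ℂ) :=
    continuous_subtype_val.comp continuous_endpoint
  have h' : Continuous fun ζ : unitTangent disk => ζ.1.1 := by fun_prop
  unfold cayleyInv
  refine continuous_const.mul (Continuous.div (h.add h') (h.sub h') fun ζ => ?_)
  exact circle_sub_ne_zero ζ.2.1 _

lemma continuous_abscissa : Continuous abscissa :=
  continuous_re.comp continuous_cayleyInv_endpoint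

lemma continuous_height : Continuous height := by
  refine Continuous.log ?_ fun ζ => (poissonKernel_pos ζ.2.1 _).ne'
  simp_rw [← cayleyInv_im]
  exact continuous_im.comp continuous_cayleyInv_endpoint

lemma orbitPt_coords (ζ : unitTangent disk) :
    orbitPt (abscissa ζ) (height ζ) (endpoint ζ) = ζ := by
  have h : hpt (abscissa ζ) (height ζ) = cayleyInv ζ.1.1 (endpoint ζ) := by
    apply Complex.ext
    · rw [hpt_re, abscissa]
    · rw [hpt_im, exp_height, cayleyInv_im]
  conv_rhs => rw [← toward_endpoint ζ]
  unfold orbitPt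
  congr 1
  apply Subtype.ext
  simp only [h]
  exact cayley_cayleyInv ζ.2.1 _

lemma endpoint_orbitPt (x t : ℝ) (θ : circle) : endpoint (orbitPt x t θ) = θ :=
  endpoint_toward _ _

lemma cayleyInv_orbitPt (x t : ℝ) (θ : circle) :
    cayleyInv (orbitPt x t θ).1.1 θ = hpt x t :=
  cayleyInv_cayley (by simp [Real.exp_pos]) θ

lemma abscissa_orbitPt (x t : ℝ) (θ : circle) : abscissa (orbitPt x t θ) = x := by
  rw [abscissa, endpoint_orbitPt, cayleyInv_orbitPt, hpt_re]

lemma height_orbitPt (x t : ℝ) (θ : circle) : height (orbitPt x t θ) = t := by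
  rw [height, endpoint_orbitPt, ← cayleyInv_im, cayleyInv_orbitPt, hpt_im, Real.log_exp]

lemma continuous_orbitPt :
    Continuous fun p : ℝ × ℝ × circle => orbitPt p.1 p.2.1 p.2.2 := by
  have hw : Continuous fun p : ℝ × ℝ × circle => hpt p.1 p.2.1 := by unfold hpt; fun_prop
  have hz : Continuous fun p : ℝ × ℝ × circle =>
      ((p.2.2 : circle) : ℂ) * ((hpt p.1 p.2.1 - I) / (hpt p.1 p.2.1 + I)) :=
    (by fun_prop : Continuous fun p : ℝ × ℝ × circle => ((p.2.2 : circle) : ℂ)).mul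
      (Continuous.div (by fun_prop) (by fun_prop) fun p => hpt_add_I_ne_zero _ _)
  refine Continuous.subtype_mk (hz.prodMk ?_) _
  refine Continuous.mul (by fun_prop) (Continuous.div (by fun_prop) (by fun_prop) fun p h => ?_)
  have h3 := congrArg norm (sub_eq_zero.1 h)
  rw [norm_one, norm_mul, norm_circle, RCLike.norm_conj, mul_one] at h3
  exact (mem_disk.1 (cayley_mem_disk (w := hpt p.1 p.2.1) (by simp [Real.exp_pos]) p.2.2)).ne h3.symm

/-- Horocyclic coordinates on the unit tangent bundle. -/
noncomputable def horoCoords : unitTangent disk ≃ₜ ℝ × ℝ × circle where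
  toFun ζ := (abscissa ζ, height ζ, endpoint ζ)
  invFun p := orbitPt p.1 p.2.1 p.2.2
  left_inv := orbitPt_coords
  right_inv p := by simp [abscissa_orbitPt, height_orbitPt, endpoint_orbitPt]
  continuous_toFun := continuous_abscissa.prodMk (continuous_height.prodMk continuous_endpoint)
  continuous_invFun := continuous_orbitPt

instance : CompactSpace circle := isCompact_iff_compactSpace.1 (isCompact_sphere _ _)

instance : LocallyCompactSpace (unitTangent disk) :=
  horoCoords.isClosedEmbedding.locallyCompactSpace

lemma rightAct_affineMat (x t : ℝ) (ζ : unitTangent disk) : rightAct (affineMat x t) ζ =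
    orbitPt (abscissa ζ + Real.exp (height ζ) * x) (height ζ + t) (endpoint ζ) := by
  conv_lhs => rw [← orbitPt_coords ζ, rightAct_orbitPt]

lemma continuous_rightAct_affineMat :
    Continuous fun p : (ℝ × ℝ) × unitTangent disk => rightAct (affineMat p.1.1 p.1.2) p.2 := by
  simp_rw [rightAct_affineMat]
  have h1 := continuous_abscissa
  have h2 := continuous_height
  have h3 := continuous_endpoint
  exact continuous_orbitPt.comp (f := fun p : (ℝ × ℝ) × unitTangent disk =>
    (abscissa p.2 + Real.exp (height p.2) * p.1.1, height p.2 + p.1.2, endpoint p.2))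
    (by fun_prop)

lemma rightAct_rightAct (A B : SL(2, ℝ)) (ζ : unitTangent disk) :
    rightAct B (rightAct A ζ) = rightAct (A * B) ζ := by
  obtain ⟨g, rfl⟩ := frame_surjective ζ
  rw [rightAct_frame, rightAct_frame, rightAct_frame, mul_assoc]

lemma rightAct_one (ζ : unitTangent disk) : rightAct 1 ζ = ζ := by
  obtain ⟨g, rfl⟩ := frame_surjective ζ
  rw [rightAct_frame, mul_one]

lemma affineMat_inv (x t : ℝ) :
    (affineMat x t)⁻¹ = affineMat (-(Real.exp (-t) * x)) (-t) := by
  rw [inv_eq_iff_mul_eq_one, affineMat_mul]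
  have h : Real.exp t * -(Real.exp (-t) * x) = -x := by
    rw [Real.exp_neg]
    field_simp
  rw [h, add_neg_cancel, add_neg_cancel]
  exact congrArg Subtype.val aff_zero

/-- The trace of a disk `U ⊆ 𝔻` on an orbit of the affine group is convex in the
coordinates of the upper half-plane. -/
lemma fst_orbitPt_mem_ball {c : ℂ} {r : ℝ} (hU : Metric.ball c r ⊆ disk) {θ : circle}
    {x₀ t₀ x₁ t₁ x t s : ℝ} (hs : 0 ≤ s) (hs' : s ≤ 1)
    (h₀ : (orbitPt x₀ t₀ θ).1.1 ∈ Metric.ball c r) (h₁ : (orbitPt x₁ t₁ θ).1.1 ∈ Metric.ball c r)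
    (hx : x = (1 - s) * x₀ + s * x₁)
    (ht : Real.exp t = (1 - s) * Real.exp t₀ + s * Real.exp t₁) :
    (orbitPt x t θ).1.1 ∈ Metric.ball c r := by
  have hr : 0 < r := Metric.pos_of_mem_ball h₀
  -- A point at infinity is not in `U`; this is the only use of `U ⊆ 𝔻`, and it fixes the sign of
  -- the leading coefficient below.
  have hθ : r ≤ ‖(θ : ℂ) - c‖ := by
    by_contra! h
    have h2 := mem_disk.1 (hU (mem_ball_iff_norm.2 h))
    rw [norm_circle] at h2
    exact lt_irrefl _ h2
  -- Clearing denominators turns membership in the ball into negativity of a quadratic polynomial in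
  -- `w = hpt x t`, whose coefficient of `|w|²` is `|θ - c|² - r² ≥ 0`. Such a polynomial is convex.
  have key : ∀ x t : ℝ, (orbitPt x t θ).1.1 ∈ Metric.ball c r ↔
      normSq (θ * (hpt x t - I) - c * (hpt x t + I)) - r ^ 2 * normSq (hpt x t + I) < 0 := by
    intro x t
    have hw := hpt_add_I_ne_zero x t
    have e : (orbitPt x t θ).1.1 - c
        = (θ * (hpt x t - I) - c * (hpt x t + I)) / (hpt x t + I) := by
      rw [orbitPt_fst]; field_simp
    rw [mem_ball_iff_norm, e, norm_div, div_lt_iff₀ (norm_pos_iff.2 hw), sub_neg,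
      normSq_eq_norm_sq, normSq_eq_norm_sq, ← mul_pow]
    exact (pow_lt_pow_iff_left₀ (norm_nonneg _) (by positivity) two_ne_zero).symm
  rw [key] at h₀ h₁ ⊢
  have hα : 0 ≤ normSq (θ - c) - r ^ 2 := by
    rw [normSq_eq_norm_sq, sub_nonneg]
    exact pow_le_pow_left₀ hr.le hθ 2
  have hw : hpt x t = (1 - s) * hpt x₀ t₀ + s * hpt x₁ t₁ := by
    simp only [hpt, ht, hx]; push_cast; ring
  -- For a quadratic polynomial the defect of convexity is explicit: the leading coefficient times
  -- `s (1 - s) |w₁ - w₀|²`.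
  have hq : normSq (θ * (hpt x t - I) - c * (hpt x t + I)) - r ^ 2 * normSq (hpt x t + I)
      = (1 - s) * (normSq (θ * (hpt x₀ t₀ - I) - c * (hpt x₀ t₀ + I))
          - r ^ 2 * normSq (hpt x₀ t₀ + I))
        + s * (normSq (θ * (hpt x₁ t₁ - I) - c * (hpt x₁ t₁ + I))
          - r ^ 2 * normSq (hpt x₁ t₁ + I))
        - s * (1 - s) * (normSq (θ - c) - r ^ 2) * normSq (hpt x₁ t₁ - hpt x₀ t₀) := by
    rw [hw]
    simp only [normSq_apply, add_re, add_im, sub_re, sub_im, mul_re, mul_im, I_re, I_im,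
      ofReal_re, ofReal_im, one_re, one_im]
    ring
  rw [hq]
  have h3 : 0 ≤ s * (1 - s) * (normSq (θ - c) - r ^ 2) * normSq (hpt x₁ t₁ - hpt x₀ t₀) :=
    mul_nonneg (mul_nonneg (mul_nonneg hs (by linarith)) hα) (normSq_nonneg _)
  rcases hs.eq_or_lt with rfl | hs0
  · linarith
  · nlinarith [mul_neg_of_pos_of_neg hs0 h₁]

/-! ### From small elements of the affine group to all elements -/

lemma continuous_rightAct_left (x t : ℝ) : Continuous (rightAct (affineMat x t)) :=
  continuous_rightAct_affineMat.comp (f := fun ζ => ((x, t), ζ))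
    (g := fun p : (ℝ × ℝ) × unitTangent disk => rightAct (affineMat p.1.1 p.1.2) p.2)
    (by fun_prop)

/-- Right translation by an element of the affine group, as a homeomorphism. -/
noncomputable def rightActHomeo (x t : ℝ) : unitTangent disk ≃ₜ unitTangent disk where
  toFun := rightAct (affineMat x t)
  invFun := rightAct (affineMat x t)⁻¹
  left_inv ζ := by rw [rightAct_rightAct, mul_inv_cancel, rightAct_one]
  right_inv ζ := by rw [rightAct_rightAct, inv_mul_cancel, rightAct_one]
  continuous_toFun := continuous_rightAct_left x t
  continuous_invFun := by
    rw [affineMat_inv]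
    exact continuous_rightAct_left _ _

lemma tsupport_comp_homeomorph_subset {X Y : Type*} [TopologicalSpace X] [TopologicalSpace Y]
    (e : X ≃ₜ Y) (f : Y → ℝ) : tsupport (f ∘ e) ⊆ e ⁻¹' tsupport f :=
  closure_minimal (fun _ hx => subset_tsupport f hx) ((isClosed_tsupport f).preimage e.continuous)

lemma continuous_incl {U : Set ℂ} (hU : U ⊆ disk) : Continuous (incl hU) :=
  continuous_inclusion (unitTangent_mono hU)

/-- Continuous functions with compact support in `T¹U`. -/
structure IsTest (U : Set ℂ) (f : unitTangent disk → ℝ) : Prop where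
  continuous : Continuous f
  hasCompactSupport : HasCompactSupport f
  tsupport_subset : tsupport f ⊆ {ζ | ζ.1.1 ∈ U}

lemma IsTest.mul_left {U : Set ℂ} {f g : unitTangent disk → ℝ} (hf : IsTest U f)
    (hg : Continuous g) : IsTest U fun ζ => g ζ * f ζ :=
  ⟨hg.mul hf.continuous, hf.hasCompactSupport.mul_left,
    tsupport_mul_subset_right.trans hf.tsupport_subset⟩

/-- Join `1` to `A` by a path `A_s` and put `F(ζ) = f(ζA) h(ζ)`. If every `F(ζ A_s⁻¹)` is supported
in `T¹U`, invariance under small elements makes its integral locally constant in `s`, and the two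
sides are the values at `s = 0` and `s = 1`. The factor `h` forces the starting point of the path
into `T¹U`, and `f` forces the end point. -/
theorem integral_rightAct_mul {c : ℂ} {r : ℝ} (hU : Metric.ball c r ⊆ disk)
    {ν : Measure (unitTangent (Metric.ball c r))} (hν : InvariantSmall hU ν)
    {f h : unitTangent disk → ℝ} (hf : IsTest (Metric.ball c r) f)
    (hh : IsTest (Metric.ball c r) h) (x t : ℝ) :
    ∫ ζ, f (rightAct (affineMat x t) (incl hU ζ)) * h (incl hU ζ) ∂ν =
      ∫ ζ, f (incl hU ζ) * h (rightAct (affineMat x t)⁻¹ (incl hU ζ)) ∂ν := by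
  -- With this choice of `τ`, the point `p A_s` traverses at constant speed the Euclidean segment
  -- from `p` to `p A` in the half-plane with `θ` at infinity; a linear path in `t` would not be
  -- straight.
  let τ : unitInterval → ℝ := fun s => Real.log (1 + s * (Real.exp t - 1))
  have hpos : ∀ s : unitInterval, 0 < 1 + s * (Real.exp t - 1) := fun s => by
    rcases s.2.1.eq_or_lt with h0 | h0
    · rw [← h0]; norm_num
    · nlinarith [mul_pos h0 (Real.exp_pos t), s.2.2]
  have hτ : ∀ s : unitInterval, Real.exp (τ s) = 1 + s * (Real.exp t - 1) := fun s =>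
    Real.exp_log (hpos s)
  have hτc : Continuous τ := Continuous.log (by fun_prop) fun s => (hpos s).ne'
  let F : unitTangent disk → ℝ := fun ζ => f (rightAct (affineMat x t) ζ) * h ζ
  have hFc : Continuous F := (hf.continuous.comp (rightActHomeo x t).continuous).mul hh.continuous
  have hFs : HasCompactSupport F := hh.hasCompactSupport.mul_left
  let e : unitInterval → unitTangent disk ≃ₜ unitTangent disk := fun s =>
    (rightActHomeo (s * x) (τ s)).symm
  have hsupp : ∀ s, tsupport (F ∘ e s) ⊆ {ζ | ζ.1.1 ∈ Metric.ball c r} := by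
    intro s ζ hζ
    have h1 : e s ζ ∈ tsupport F := tsupport_comp_homeomorph_subset _ _ hζ
    have h2 := hh.tsupport_subset (tsupport_mul_subset_right h1)
    have h3 : rightActHomeo x t (e s ζ) ∈ tsupport f :=
      tsupport_comp_homeomorph_subset (rightActHomeo x t) f (tsupport_mul_subset_left h1)
    have h3 := hf.tsupport_subset h3
    have h4 : ζ = rightAct (affineMat (s * x) (τ s)) (e s ζ) :=
      ((rightActHomeo (s * x) (τ s)).apply_symm_apply ζ).symm
    generalize e s ζ = p at h2 h3 h4
    change (rightAct (affineMat x t) p).1.1 ∈ Metric.ball c r at h3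
    rw [Set.mem_ofPred_eq, ← orbitPt_coords p] at h2
    rw [rightAct_affineMat] at h3 h4
    rw [h4]
    refine fst_orbitPt_mem_ball hU s.2.1 s.2.2 h2 h3 ?_ ?_
    · ring
    · rw [Real.exp_add, Real.exp_add, hτ]; ring
  have hloc : IsLocallyConstant fun s => ∫ ζ, F (e s (incl hU ζ)) ∂ν := by
    rw [IsLocallyConstant.iff_eventually_eq]
    intro s
    have h1 := hν (F ∘ e s) (hFc.comp (e s).continuous) (hFs.comp_homeomorph (e s)) (hsupp s)
    -- Translation by `A_{s'}⁻¹` is translation by the small element `A_{s'}⁻¹ A_s` followed by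
    -- translation by `A_s⁻¹`.
    let β : unitInterval → affineGroup := fun s' => (aff (s' * x) (τ s'))⁻¹ * aff (s * x) (τ s)
    have hα : Continuous fun s' : unitInterval => aff (s' * x) (τ s') :=
      continuous_aff.comp (f := fun s' : unitInterval => ((s' : ℝ) * x, τ s')) (by fun_prop)
    have hβ : Tendsto β (𝓝 s) (𝓝 1) := by
      have : β s = 1 := inv_mul_cancel _
      rw [← this]
      exact (hα.inv.mul continuous_const).tendsto s
    filter_upwards [hβ.eventually h1] with s' hs'
    refine Eq.trans (integral_congr_ae (Eventually.of_forall fun ζ => ?_)) hs'.symm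
    have h2 : ∀ ξ, rightAct (affineMat (s * x) (τ s))⁻¹ (rightAct (β s') ξ) =
        rightAct (affineMat (s' * x) (τ s'))⁻¹ ξ := by
      intro ξ
      rw [rightAct_rightAct]
      congr 1
      exact mul_inv_cancel_right _ _
    exact congrArg F (h2 (incl hU ζ)).symm
  have h01 := hloc.apply_eq_of_preconnectedSpace 0 1
  have e0 : ∀ ζ, e 0 ζ = ζ := fun ζ => by
    have h1 : τ 0 = 0 := by simp [τ]
    have h2 : affineMat 0 0 = 1 := congrArg Subtype.val aff_zero
    change rightAct (affineMat ((0 : unitInterval) * x) (τ 0))⁻¹ ζ = ζ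
    rw [h1, Set.Icc.coe_zero, zero_mul, h2, inv_one, rightAct_one]
  have e1 : ∀ ζ, e 1 ζ = rightAct (affineMat x t)⁻¹ ζ := fun ζ => by
    have h1 : τ 1 = t := by simp [τ]
    change rightAct (affineMat ((1 : unitInterval) * x) (τ 1))⁻¹ ζ = _
    rw [h1, Set.Icc.coe_one, one_mul]
  have e2 : ∀ ζ, rightAct (affineMat x t) (rightAct (affineMat x t)⁻¹ ζ) = ζ := fun ζ =>
    (rightActHomeo x t).apply_symm_apply ζ
  simpa only [F, e0, e1, e2] using h01

/-! ### Integration over orbits -/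

lemma lintegral_comp_affine {a : ℝ} (ha : a ≠ 0) (b : ℝ) {g : ℝ → ℝ≥0∞} (hg : Measurable g) :
    ∫⁻ x, g (b + a * x) = ENNReal.ofReal |a⁻¹| * ∫⁻ x, g x := by
  rw [← lintegral_add_left_eq_self (μ := volume) g b,
    ← lintegral_map (f := fun x => g (b + x)) (by fun_prop) (measurable_const_mul a),
    Real.map_volume_mul_left ha, lintegral_smul_measure, smul_eq_mul]

/-- Integral of a function over an orbit of the affine group, with respect to right Haar measure. -/
noncomputable def orbitLIntegral (F : unitTangent disk → ℝ≥0∞) (θ : circle) : ℝ≥0∞ :=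
  ∫⁻ p : ℝ × ℝ, F (orbitPt p.1 p.2 θ)

lemma measurable_orbitPt : Measurable fun p : ℝ × ℝ × circle => orbitPt p.1 p.2.1 p.2.2 :=
  continuous_orbitPt.measurable

lemma measurable_orbitPt_left (θ : circle) :
    Measurable fun p : ℝ × ℝ => orbitPt p.1 p.2 θ :=
  measurable_orbitPt.comp (g := fun p : ℝ × ℝ × circle => orbitPt p.1 p.2.1 p.2.2)
    (f := fun p : ℝ × ℝ => (p.1, p.2, θ)) (by fun_prop)

lemma measurable_orbitLIntegral {F : unitTangent disk → ℝ≥0∞} (hF : Measurable F) :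
    Measurable (orbitLIntegral F) := by
  refine Measurable.lintegral_prod_right' (f := fun q : circle × ℝ × ℝ =>
    F (orbitPt q.2.1 q.2.2 q.1)) (hF.comp ?_)
  exact measurable_orbitPt.comp (g := fun p : ℝ × ℝ × circle => orbitPt p.1 p.2.1 p.2.2)
    (f := fun q : circle × ℝ × ℝ => (q.2.1, q.2.2, q.1)) (by fun_prop)

/-- The measure `dx dt` is a right but not a left Haar measure of the affine group; the factor is
the inverse Jacobian of a left translation. -/
lemma lintegral_shear {g : ℝ × ℝ → ℝ≥0∞} (hg : Measurable g) (x t : ℝ) :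
    ∫⁻ p : ℝ × ℝ, g (x + Real.exp t * p.1, t + p.2) =
      ENNReal.ofReal (Real.exp (-t)) * ∫⁻ p, g p := by
  rw [Measure.volume_eq_prod,
    lintegral_prod_symm' (fun p : ℝ × ℝ => g (x + Real.exp t * p.1, t + p.2))
      (hg.comp (by fun_prop)), lintegral_prod_symm' _ hg]
  have h : ∀ s, ∫⁻ x', g (x + Real.exp t * x', t + s) =
      ENNReal.ofReal (Real.exp (-t)) * ∫⁻ x', g (x', t + s) := fun s => by
    rw [lintegral_comp_affine (g := fun x' => g (x', t + s)) (Real.exp_pos _).ne' _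
      (hg.comp (by fun_prop)), ← Real.exp_neg, abs_of_pos (Real.exp_pos _)]
  have hm : Measurable fun s => ∫⁻ x', g (x', s) := Measurable.lintegral_prod_left' hg
  simp_rw [h]
  rw [lintegral_const_mul (f := fun s => ∫⁻ x', g (x', t + s)) _
      (hm.comp (measurable_const_add t)),
    lintegral_add_left_eq_self (μ := volume) (fun s => ∫⁻ x', g (x', s)) t]

/-- Here the group variable enters through its inverse. The weight is the modular factor that
cancels the Jacobian of this substitution. -/
lemma lintegral_inv_shear {g : ℝ × ℝ → ℝ≥0∞} (hg : Measurable g) (x t : ℝ) :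
    ∫⁻ p : ℝ × ℝ, ENNReal.ofReal (Real.exp (t - p.2)) *
      g (x + -Real.exp (t - p.2) * p.1, t - p.2) = ∫⁻ p, g p := by
  rw [Measure.volume_eq_prod,
    lintegral_prod_symm' (fun p : ℝ × ℝ => ENNReal.ofReal (Real.exp (t - p.2)) *
      g (x + -Real.exp (t - p.2) * p.1, t - p.2))
      (Measurable.mul (by fun_prop) (hg.comp (by fun_prop))), lintegral_prod_symm' _ hg]
  have h : ∀ s, ∫⁻ x', ENNReal.ofReal (Real.exp (t - s)) *
      g (x + -Real.exp (t - s) * x', t - s) = ∫⁻ x', g (x', t - s) := fun s => by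
    rw [lintegral_const_mul (f := fun x' => g (x + -Real.exp (t - s) * x', t - s)) _
        (hg.comp (by fun_prop)),
      lintegral_comp_affine (g := fun x' => g (x', t - s)) (neg_ne_zero.2 (Real.exp_pos _).ne') _
        (hg.comp (by fun_prop)), abs_inv, abs_neg,
      abs_of_pos (Real.exp_pos _), ← mul_assoc, ← ENNReal.ofReal_mul (Real.exp_pos _).le,
      mul_inv_cancel₀ (Real.exp_pos _).ne', ENNReal.ofReal_one, one_mul]
  simp_rw [h]
  exact lintegral_sub_left_eq_self (μ := volume) (fun s => ∫⁻ x', g (x', s)) t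

lemma lintegral_rightAct {F : unitTangent disk → ℝ≥0∞} (hF : Measurable F)
    (ζ : unitTangent disk) :
    ∫⁻ p : ℝ × ℝ, F (rightAct (affineMat p.1 p.2) ζ) =
      ENNReal.ofReal (Real.exp (-height ζ)) * orbitLIntegral F (endpoint ζ) := by
  simp_rw [rightAct_affineMat, orbitLIntegral]
  exact lintegral_shear (g := fun p => F (orbitPt p.1 p.2 (endpoint ζ)))
    (hF.comp (measurable_orbitPt_left (endpoint ζ))) _ _

lemma lintegral_rightAct_inv {F : unitTangent disk → ℝ≥0∞} (hF : Measurable F)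
    (ζ : unitTangent disk) :
    ∫⁻ p : ℝ × ℝ, ENNReal.ofReal (Real.exp (height (rightAct (affineMat p.1 p.2)⁻¹ ζ))) *
        F (rightAct (affineMat p.1 p.2)⁻¹ ζ) =
      orbitLIntegral F (endpoint ζ) := by
  have hb : ∀ x t : ℝ, abscissa ζ + Real.exp (height ζ) * -(Real.exp (-t) * x)
      = abscissa ζ + -Real.exp (height ζ - t) * x := fun x t => by
    rw [sub_eq_add_neg (height ζ), Real.exp_add]; ring
  simp_rw [affineMat_inv, rightAct_affineMat, height_orbitPt, orbitLIntegral, hb,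
    ← sub_eq_add_neg (height ζ)]
  exact lintegral_inv_shear (g := fun p => F (orbitPt p.1 p.2 (endpoint ζ)))
    (hF.comp (measurable_orbitPt_left (endpoint ζ))) _ _

lemma continuous_rightAct_inv :
    Continuous fun p : (ℝ × ℝ) × unitTangent disk => rightAct (affineMat p.1.1 p.1.2)⁻¹ p.2 := by
  simp_rw [affineMat_inv]
  exact continuous_rightAct_affineMat.comp (f := fun p : (ℝ × ℝ) × unitTangent disk =>
    ((-(Real.exp (-p.1.2) * p.1.1), -p.1.2), p.2))
    (g := fun p : (ℝ × ℝ) × unitTangent disk => rightAct (affineMat p.1.1 p.1.2) p.2)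
    (by fun_prop)

lemma lintegral_rightAct_mul {c : ℂ} {r : ℝ} (hU : Metric.ball c r ⊆ disk)
    {ν : Measure (unitTangent (Metric.ball c r))} [IsFiniteMeasure ν] (hν : InvariantSmall hU ν)
    {f h : unitTangent disk → ℝ} (hf : IsTest (Metric.ball c r) f) (hf0 : 0 ≤ f)
    (hh : IsTest (Metric.ball c r) h) (hh0 : 0 ≤ h) (x t : ℝ) :
    ∫⁻ ζ, ENNReal.ofReal (h (incl hU ζ)) *
        ENNReal.ofReal (f (rightAct (affineMat x t) (incl hU ζ))) ∂ν =
      ∫⁻ ζ, ENNReal.ofReal (f (incl hU ζ)) *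
        ENNReal.ofReal (h (rightAct (affineMat x t)⁻¹ (incl hU ζ))) ∂ν := by
  have hi := continuous_incl hU
  have hint : ∀ g : unitTangent disk → ℝ, Continuous g → HasCompactSupport g →
      Integrable (fun ζ => g (incl hU ζ)) ν := fun g hg hgs => by
    have h1 : Integrable g (ν.map (incl hU)) := hg.integrable_of_hasCompactSupport hgs
    exact h1.comp_measurable hi.measurable
  have hc1 : Continuous fun ζ => f (rightAct (affineMat x t) ζ) :=
    hf.continuous.comp (rightActHomeo x t).continuous
  have hc2 : Continuous fun ζ => h (rightAct (affineMat x t)⁻¹ ζ) :=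
    hh.continuous.comp (rightActHomeo x t).symm.continuous
  have h2 := congrArg ENNReal.ofReal (integral_rightAct_mul hU hν hf hh x t)
  rw [ofReal_integral_eq_lintegral_ofReal
      (hint (fun ζ => f (rightAct (affineMat x t) ζ) * h ζ)
        (hc1.mul hh.continuous) hh.hasCompactSupport.mul_left)
      (Eventually.of_forall fun ζ => mul_nonneg (hf0 _) (hh0 _)),
    ofReal_integral_eq_lintegral_ofReal
      (hint (fun ζ => f ζ * h (rightAct (affineMat x t)⁻¹ ζ))
        (hf.continuous.mul hc2) hf.hasCompactSupport.mul_right)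
      (Eventually.of_forall fun ζ => mul_nonneg (hf0 _) (hh0 _))] at h2
  simp_rw [ENNReal.ofReal_mul (hf0 _)] at h2
  rw [← h2]
  exact lintegral_congr fun ζ => mul_comm _ _

/-- Integrate `lintegral_rightAct_mul` over the whole affine group and exchange integrals. Since the
group is not unimodular, `h` is first multiplied by `e^height`, which remains a test function: the
weight cancels the factor of `lintegral_rightAct` on one side and is the one required by
`lintegral_rightAct_inv` on the other. -/
theorem lintegral_mul_orbitLIntegral_comm {c : ℂ} {r : ℝ} (hU : Metric.ball c r ⊆ disk)
    {ν : Measure (unitTangent (Metric.ball c r))} [IsFiniteMeasure ν] (hν : InvariantSmall hU ν)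
    {f h : unitTangent disk → ℝ} (hf : IsTest (Metric.ball c r) f) (hf0 : 0 ≤ f)
    (hh : IsTest (Metric.ball c r) h) (hh0 : 0 ≤ h) :
    ∫⁻ ζ, ENNReal.ofReal (f (incl hU ζ)) *
        orbitLIntegral (fun ξ => ENNReal.ofReal (h ξ)) (endpoint (incl hU ζ)) ∂ν =
      ∫⁻ ζ, ENNReal.ofReal (h (incl hU ζ)) *
        orbitLIntegral (fun ξ => ENNReal.ofReal (f ξ)) (endpoint (incl hU ζ)) ∂ν := by
  have hi := (continuous_incl hU).measurable
  have hfm : Measurable fun ξ => ENNReal.ofReal (f ξ) := hf.continuous.measurable.ennreal_ofReal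
  have hhm : Measurable fun ξ => ENNReal.ofReal (h ξ) := hh.continuous.measurable.ennreal_ofReal
  have hy : Continuous fun ζ => Real.exp (height ζ) := Real.continuous_exp.comp continuous_height
  have hyh : Measurable fun ζ => ENNReal.ofReal (Real.exp (height ζ) * h ζ) :=
    (hy.mul hh.continuous).measurable.ennreal_ofReal
  have hact := continuous_rightAct_affineMat.measurable
  have hact' := continuous_rightAct_inv.measurable
  have h1 : Measurable fun q : unitTangent (Metric.ball c r) × ℝ × ℝ =>
      rightAct (affineMat q.2.1 q.2.2) (incl hU q.1) :=
    hact.comp (f := fun q : unitTangent (Metric.ball c r) × ℝ × ℝ => (q.2, incl hU q.1))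
      (measurable_snd.prodMk (hi.comp measurable_fst))
  have h2 : Measurable fun q : (ℝ × ℝ) × unitTangent (Metric.ball c r) =>
      rightAct (affineMat q.1.1 q.1.2)⁻¹ (incl hU q.2) :=
    hact'.comp (f := fun q : (ℝ × ℝ) × unitTangent (Metric.ball c r) => (q.1, incl hU q.2))
      (measurable_fst.prodMk (hi.comp measurable_snd))
  symm
  calc
    _ = ∫⁻ ζ, (∫⁻ p : ℝ × ℝ, ENNReal.ofReal (Real.exp (height (incl hU ζ)) * h (incl hU ζ)) *
          ENNReal.ofReal (f (rightAct (affineMat p.1 p.2) (incl hU ζ)))) ∂ν := by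
      refine lintegral_congr fun ζ => ?_
      rw [lintegral_const_mul' _ _ ENNReal.ofReal_ne_top,
        lintegral_rightAct hfm, ENNReal.ofReal_mul (Real.exp_pos _).le,
        mul_comm (ENNReal.ofReal (Real.exp _)), mul_assoc,
        ← mul_assoc (ENNReal.ofReal (Real.exp _)), ← ENNReal.ofReal_mul (Real.exp_pos _).le,
        ← Real.exp_add, add_neg_cancel, Real.exp_zero, ENNReal.ofReal_one, one_mul]
    _ = ∫⁻ p : ℝ × ℝ, ∫⁻ ζ, ENNReal.ofReal (Real.exp (height (incl hU ζ)) * h (incl hU ζ)) *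
          ENNReal.ofReal (f (rightAct (affineMat p.1 p.2) (incl hU ζ))) ∂ν :=
      lintegral_lintegral_swap (Measurable.aemeasurable
        ((hyh.comp (hi.comp measurable_fst)).mul (hfm.comp h1)))
    _ = ∫⁻ p : ℝ × ℝ, ∫⁻ ζ, ENNReal.ofReal (f (incl hU ζ)) *
          ENNReal.ofReal (Real.exp (height (rightAct (affineMat p.1 p.2)⁻¹ (incl hU ζ))) *
            h (rightAct (affineMat p.1 p.2)⁻¹ (incl hU ζ))) ∂ν :=
      lintegral_congr fun p => lintegral_rightAct_mul hU hν hf hf0 (hh.mul_left hy)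
        (fun ζ => mul_nonneg (Real.exp_pos _).le (hh0 _)) p.1 p.2
    _ = ∫⁻ ζ, (∫⁻ p : ℝ × ℝ, ENNReal.ofReal (f (incl hU ζ)) *
          ENNReal.ofReal (Real.exp (height (rightAct (affineMat p.1 p.2)⁻¹ (incl hU ζ))) *
            h (rightAct (affineMat p.1 p.2)⁻¹ (incl hU ζ)))) ∂ν :=
      lintegral_lintegral_swap (Measurable.aemeasurable
        ((hfm.comp (hi.comp measurable_snd)).mul (hyh.comp h2)))
    _ = _ := by
      refine lintegral_congr fun ζ => ?_
      rw [← lintegral_rightAct_inv hhm (incl hU ζ)]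
      rw [← lintegral_const_mul' _ _ ENNReal.ofReal_ne_top]
      exact lintegral_congr fun p => congrArg _ (ENNReal.ofReal_mul (Real.exp_pos _).le)

/-! ### Area in horocyclic coordinates -/

lemma lintegral_comp_exp (u : ℝ → ℝ≥0∞) :
    ∫⁻ t, u (Real.exp t) = ∫⁻ y in Set.Ioi 0, ENNReal.ofReal y⁻¹ * u y := by
  rw [← Real.range_exp, ← Set.image_univ,
    lintegral_image_eq_lintegral_abs_deriv_mul MeasurableSet.univ
      (fun x _ => (Real.hasDerivAt_exp x).hasDerivWithinAt) Real.exp_injective.injOn,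
    setLIntegral_univ]
  refine lintegral_congr fun t => ?_
  rw [← mul_assoc, ← ENNReal.ofReal_mul (abs_nonneg _), abs_of_pos (Real.exp_pos t),
    mul_inv_cancel₀ (Real.exp_pos t).ne', ENNReal.ofReal_one, one_mul]

/-- With `y = e^t`, the measure `dx dt` is `dx dy / y`. -/
lemma lintegral_hpt {H : ℂ → ℝ≥0∞} (hH : Measurable H) :
    ∫⁻ p : ℝ × ℝ, H (hpt p.1 p.2) = ∫⁻ w in {w : ℂ | 0 < w.im}, ENNReal.ofReal w.im⁻¹ * H w := by
  have hc : Continuous fun p : ℝ × ℝ => hpt p.1 p.2 := by unfold hpt; fun_prop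
  have hs : MeasurableSet {w : ℂ | 0 < w.im} := measurableSet_lt measurable_const measurable_im
  let K : ℂ → ℝ≥0∞ := {w : ℂ | 0 < w.im}.indicator fun w => ENNReal.ofReal w.im⁻¹ * H w
  have hK : Measurable K := (Measurable.mul (by fun_prop) hH).indicator hs
  rw [← lintegral_indicator hs]
  change _ = ∫⁻ w, K w
  rw [← volume_preserving_equiv_real_prod.symm.lintegral_comp_emb
      measurableEquivRealProd.symm.measurableEmbedding, Measure.volume_eq_prod,
    lintegral_prod (fun p : ℝ × ℝ => H (hpt p.1 p.2)) (hH.comp hc.measurable).aemeasurable,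
    lintegral_prod (fun p => K (measurableEquivRealProd.symm p))
      (hK.comp measurableEquivRealProd.symm.measurable).aemeasurable]
  refine lintegral_congr fun x => ?_
  have h1 := lintegral_comp_exp fun y => H (x + y * I)
  have h2 : ∀ t, hpt x t = x + (Real.exp t : ℝ) * I := fun t => rfl
  simp_rw [h2, h1]
  rw [← lintegral_indicator measurableSet_Ioi]
  refine lintegral_congr fun y => ?_
  have h3 : measurableEquivRealProd.symm (x, y) = x + y * I := by
    apply Complex.ext <;> simp [measurableEquivRealProd_symm_apply]
  rw [h3]
  simp [K, Set.indicator_apply]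

lemma hasDerivAt_cayley {w : ℂ} (hw : 0 < w.im) (θ : circle) :
    HasDerivAt (fun w => (θ : ℂ) * ((w - I) / (w + I))) (θ * (2 * I / (w + I) ^ 2)) w := by
  have h := add_I_ne_zero hw
  have h1 := (((hasDerivAt_id w).sub_const I).div ((hasDerivAt_id w).add_const I) h).const_mul
    (θ : ℂ)
  refine h1.congr_deriv ?_
  rw [id]
  ring

lemma image_cayley (θ : circle) :
    (fun w => (θ : ℂ) * ((w - I) / (w + I))) '' {w : ℂ | 0 < w.im} = disk := by
  ext z
  constructor
  · rintro ⟨w, hw, rfl⟩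
    exact cayley_mem_disk hw θ
  · intro hz
    refine ⟨cayleyInv z θ, ?_, cayley_cayleyInv hz θ⟩
    change 0 < (cayleyInv z θ).im
    rw [cayleyInv_im]
    exact poissonKernel_pos hz θ

lemma lintegral_cayley (G : ℂ → ℝ≥0∞) (θ : circle) :
    ∫⁻ z in disk, G z = ∫⁻ w in {w : ℂ | 0 < w.im},
      ENNReal.ofReal (4 / ‖w + I‖ ^ 4) * G (θ * ((w - I) / (w + I))) := by
  have hs : MeasurableSet {w : ℂ | 0 < w.im} := measurableSet_lt measurable_const measurable_im
  have hinj : Set.InjOn (fun w => (θ : ℂ) * ((w - I) / (w + I))) {w : ℂ | 0 < w.im} :=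
    fun w hw w' hw' h => by
      rw [← cayleyInv_cayley hw θ, ← cayleyInv_cayley hw' θ]
      exact congrArg (fun z => cayleyInv z θ) h
  rw [← image_cayley θ, lintegral_image_eq_lintegral_abs_det_fderiv_mul volume hs
    (fun w hw => ((hasDerivAt_cayley hw θ).hasFDerivAt.restrictScalars ℝ).hasFDerivWithinAt) hinj]
  refine setLIntegral_congr_fun hs fun w hw => ?_
  have hdet : ∀ a : ℂ, ((ContinuousLinearMap.toSpanSingleton ℂ a).restrictScalars ℝ).det
      = normSq a := fun a => by
    simp [ContinuousLinearMap.det, LinearMap.det_restrictScalars, Algebra.norm_complex_eq]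
  have h4 : normSq ((θ : ℂ) * (2 * I / (w + I) ^ 2)) = 4 / ‖w + I‖ ^ 4 := by
    simp only [normSq_eq_norm_sq, norm_mul, norm_circle, norm_div, norm_I, norm_pow,
      Complex.norm_ofNat]
    ring
  simp only [hdet, h4]
  rw [abs_of_nonneg (by positivity)]

/-- In horocyclic coordinates, hyperbolic area times the Poisson kernel is Lebesgue measure. -/
theorem lintegral_cayley_hpt {G : ℂ → ℝ≥0∞} (hG : Measurable G) (θ : circle) :
    ∫⁻ p : ℝ × ℝ, G (θ * ((hpt p.1 p.2 - I) / (hpt p.1 p.2 + I))) =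
      ∫⁻ z in disk, ENNReal.ofReal (4 / (1 - ‖z‖ ^ 2) ^ 2) *
        (G z * ENNReal.ofReal (poissonKernel 0 z θ)) := by
  have hs : MeasurableSet {w : ℂ | 0 < w.im} := measurableSet_lt measurable_const measurable_im
  rw [lintegral_hpt (H := fun w => G (θ * ((w - I) / (w + I)))) (hG.comp (by fun_prop)),
    lintegral_cayley _ θ]
  refine setLIntegral_congr_fun hs fun w hw => ?_
  have hw' : 0 < w.im := hw
  have h := norm_pos_iff.2 (add_I_ne_zero hw')
  simp only [poissonKernel_cayley hw', one_sub_norm_cayley_sq hw']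
  rw [mul_comm (G _), ← mul_assoc, ← mul_assoc, ← ENNReal.ofReal_mul (by positivity),
    ← ENNReal.ofReal_mul (by positivity)]
  -- The powers of `|w + i|` in the Jacobian `4 / |w + i|⁴` and in the area density cancel, leaving
  -- `y⁻²`; the Poisson kernel contributes `y`.
  congr 2
  field_simp

lemma lintegral_area {U : Set ℂ} (hU : MeasurableSet U) (G : ℂ → ℝ≥0∞) (hG : Measurable G) :
    ∫⁻ z : U, G z ∂(area U) = ∫⁻ z in U, ENNReal.ofReal (4 / (1 - ‖z‖ ^ 2) ^ 2) * G z := by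
  rw [area, lintegral_subtype_comap hU, restrict_withDensity hU,
    lintegral_withDensity_eq_lintegral_mul _ (by fun_prop) hG]
  rfl

lemma sigmaFinite_area {U : Set ℂ} (hU : MeasurableSet U) : SigmaFinite (area U) := by
  have : SigmaFinite (volume.withDensity fun z : ℂ => ENNReal.ofReal (4 / (1 - ‖z‖ ^ 2) ^ 2)) :=
    SigmaFinite.withDensity_of_ne_top (Eventually.of_forall fun _ => ENNReal.ofReal_ne_top)
  refine SigmaFinite.of_map _ measurable_subtype_coe.aemeasurable ?_
  rw [area, (MeasurableEmbedding.subtype_coe hU).map_comap]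
  infer_instance

/-! ### The measure attached to a measure on the circle -/

lemma continuous_toward {U : Set ℂ} (hU : U ⊆ disk) :
    Continuous fun p : U × circle => toward hU p.1 p.2 := by
  refine Continuous.subtype_mk (Continuous.prodMk (by fun_prop) ?_) _
  refine Continuous.mul (by fun_prop) (Continuous.div (by fun_prop) (by fun_prop) fun p h => ?_)
  have h3 := congrArg norm (sub_eq_zero.1 h)
  rw [norm_one, norm_mul, norm_circle, RCLike.norm_conj, mul_one] at h3
  exact (mem_disk.1 (hU p.1.2)).ne h3.symm

lemma continuous_poissonKernel {U : Set ℂ} (hU : U ⊆ disk) :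
    Continuous fun p : U × circle => poissonKernel 0 (p.1 : ℂ) (p.2 : ℂ) := by
  unfold poissonKernel
  refine Continuous.div (by fun_prop) (by fun_prop) fun p => ?_
  rw [sub_zero, sub_zero]
  exact pow_ne_zero _ (norm_ne_zero_iff.2 (circle_sub_ne_zero (hU p.1.2) p.2))

lemma measurable_ofReal_poissonKernel {U : Set ℂ} (hU : U ⊆ disk) :
    Measurable fun p : circle × U => ENNReal.ofReal (poissonKernel 0 (p.2 : ℂ) (p.1 : ℂ)) :=
  ((continuous_poissonKernel hU).comp continuous_swap).measurable.ennreal_ofReal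

/-- The measure `k(z, θ) dz dφ(θ)` on `T¹U`. -/
noncomputable def poissonMeasure {U : Set ℂ} (hU : U ⊆ disk) (φ : Measure circle) :
    Measure (unitTangent U) :=
  ((φ.prod (area U)).withDensity fun p => ENNReal.ofReal (poissonKernel 0 (p.2 : ℂ) (p.1 : ℂ))).map
    fun p => toward hU p.2 p.1

lemma lintegral_poissonMeasure {U : Set ℂ} (hU : U ⊆ disk) (hU' : MeasurableSet U)
    (φ : Measure circle) [SFinite φ] {F : unitTangent U → ℝ≥0∞} (hF : Measurable F) :
    ∫⁻ ζ, F ζ ∂(poissonMeasure hU φ) = poissonLIntegral φ fun z θ => F (toward hU z θ) := by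
  have := sigmaFinite_area hU'
  have hm : Measurable fun p : circle × U => toward hU p.2 p.1 :=
    ((continuous_toward hU).comp continuous_swap).measurable
  have hk := measurable_ofReal_poissonKernel hU
  have hFm : Measurable fun p : circle × U => F (toward hU p.2 p.1) := hF.comp hm
  rw [poissonMeasure, lintegral_map hF hm, lintegral_withDensity_eq_lintegral_mul _ hk hFm,
    lintegral_prod _ (hk.mul hFm).aemeasurable, poissonLIntegral]
  refine lintegral_congr fun θ => lintegral_congr fun z => ?_
  exact mul_comm _ _

lemma poissonLIntegral_withDensity {U : Set ℂ} (hU : U ⊆ disk) (hU' : MeasurableSet U)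
    (φ : Measure circle) {w : circle → ℝ≥0∞} (hw : Measurable w)
    {F : U → circle → ℝ≥0∞} (hF : Measurable fun p : circle × U => F p.2 p.1) :
    poissonLIntegral (φ.withDensity w) F = poissonLIntegral φ fun z θ => w θ * F z θ := by
  have := sigmaFinite_area hU'
  have hm : Measurable fun p : circle × U =>
      F p.2 p.1 * ENNReal.ofReal (poissonKernel 0 (p.2 : ℂ) (p.1 : ℂ)) :=
    hF.mul (measurable_ofReal_poissonKernel hU)
  unfold poissonLIntegral
  rw [lintegral_withDensity_eq_lintegral_mul _ hw hm.lintegral_prod_right']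
  refine lintegral_congr fun θ => ?_
  have hmθ : Measurable fun z : U => F z θ * ENNReal.ofReal (poissonKernel 0 (z : ℂ) (θ : ℂ)) :=
    hm.comp measurable_prodMk_left
  rw [Pi.mul_apply, ← lintegral_const_mul _ hmθ]
  exact lintegral_congr fun z => (mul_assoc _ _ _).symm

/-- This is the bridge from Lebesgue measure on orbits to `k(z, θ) dz`: `lintegral_cayley_hpt` gives
the integral over all of `𝔻`, and the vanishing of `F` off `T¹U` cuts it down to `U`. -/
lemma orbitLIntegral_eq {U : Set ℂ} (hU : U ⊆ disk) (hU' : MeasurableSet U)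
    {F : unitTangent disk → ℝ≥0∞} (hF : Measurable F) (hF0 : ∀ ζ, ζ.1.1 ∉ U → F ζ = 0)
    (θ : circle) :
    orbitLIntegral F θ =
      ∫⁻ z, F (incl hU (toward hU z θ)) *
        ENNReal.ofReal (poissonKernel 0 (z : ℂ) (θ : ℂ)) ∂(area U) := by
  have hd : MeasurableSet disk := Metric.isOpen_ball.measurableSet
  let G : ℂ → ℝ≥0∞ :=
    Function.extend ((↑) : disk → ℂ) (fun z => F (toward Set.Subset.rfl z θ)) 0
  have hG : Measurable G := (MeasurableEmbedding.subtype_coe hd).measurable_extend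
    (hF.comp ((continuous_toward Set.Subset.rfl).comp
      (Continuous.prodMk_left θ)).measurable) measurable_const
  have hGd : ∀ z : disk, G z = F (toward Set.Subset.rfl z θ) := fun z =>
    Subtype.val_injective.extend_apply _ _ z
  have hG0 : ∀ z, z ∈ disk → z ∉ U → G z = 0 := fun z hz hzU => by
    rw [hGd ⟨z, hz⟩]; exact hF0 _ hzU
  have hk : Measurable fun z => ENNReal.ofReal (poissonKernel 0 z (θ : ℂ)) := by
    unfold poissonKernel; fun_prop
  have h1 : ∀ p : ℝ × ℝ, F (orbitPt p.1 p.2 θ) =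
      G (θ * ((hpt p.1 p.2 - I) / (hpt p.1 p.2 + I))) := fun p =>
    (hGd ⟨_, cayley_mem_disk (by simp [Real.exp_pos]) θ⟩).symm
  have h2 : ∀ z : U, F (incl hU (toward hU z θ)) = G z := fun z => (hGd ⟨z, hU z.2⟩).symm
  simp_rw [orbitLIntegral, h1, h2]
  rw [lintegral_cayley_hpt hG, lintegral_area hU' (fun z =>
      G z * ENNReal.ofReal (poissonKernel 0 z (θ : ℂ))) (hG.mul hk), ← lintegral_indicator hd,
    ← lintegral_indicator hU']
  refine lintegral_congr fun z => ?_
  by_cases hz : z ∈ U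
  · rw [Set.indicator_of_mem hz, Set.indicator_of_mem (hU hz)]
  · rw [Set.indicator_of_notMem hz]
    by_cases hz' : z ∈ disk
    · rw [Set.indicator_of_mem hz', hG0 z hz' hz, zero_mul, mul_zero]
    · rw [Set.indicator_of_notMem hz']

/-! ### Test functions determine measures -/

/-- Only one measure is assumed finite: comparison on a bump function equal to `1` on a compact set
shows that the other is finite on compact sets, after which Riesz uniqueness applies. -/
lemma measure_eq_of_lintegral_eq {X : Type*} [MetricSpace X] [LocallyCompactSpace X]
    [SecondCountableTopology X] [MeasurableSpace X] [BorelSpace X] {μ ν : Measure X}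
    [IsFiniteMeasure μ]
    (h : ∀ f : X → ℝ, Continuous f → HasCompactSupport f → 0 ≤ f →
      ∫⁻ x, ENNReal.ofReal (f x) ∂μ = ∫⁻ x, ENNReal.ofReal (f x) ∂ν) : μ = ν := by
  have : IsFiniteMeasureOnCompacts ν := by
    refine ⟨fun K hK => ?_⟩
    obtain ⟨f, hf1, -, hf2, hf3⟩ := exists_continuous_one_zero_of_isCompact hK
      isClosed_empty (Set.disjoint_empty K)
    calc ν K = ∫⁻ x, K.indicator 1 x ∂ν := (lintegral_indicator_one hK.measurableSet).symm
      _ ≤ ∫⁻ x, ENNReal.ofReal (f x) ∂ν := by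
        refine lintegral_mono fun x => ?_
        by_cases hx : x ∈ K
        · simp [hx, hf1 hx]
        · simp [hx]
      _ = ∫⁻ x, ENNReal.ofReal (f x) ∂μ := (h f f.continuous hf2 fun x => (hf3 x).1).symm
      _ ≤ ∫⁻ _, 1 ∂μ := lintegral_mono fun x => ENNReal.ofReal_le_one.2 (hf3 x).2
      _ < ∞ := by rw [lintegral_one]; exact measure_lt_top _ _
  refine Measure.ext_of_integral_eq_on_compactlySupported_nnreal fun f => ?_
  have hc : Continuous fun x => (f x : ℝ) := NNReal.continuous_coe.comp f.continuous
  have hs : HasCompactSupport fun x => (f x : ℝ) :=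
    f.hasCompactSupport.comp_left (g := ((↑) : NNReal → ℝ)) NNReal.coe_zero
  have h0 : 0 ≤ fun x => (f x : ℝ) := fun x => (f x).2
  rw [integral_eq_lintegral_of_nonneg_ae (Eventually.of_forall h0) hc.aestronglyMeasurable,
    integral_eq_lintegral_of_nonneg_ae (Eventually.of_forall h0) hc.aestronglyMeasurable,
    h _ hc hs h0]

lemma isOpenEmbedding_incl {U : Set ℂ} (hU : U ⊆ disk) (hU' : IsOpen U) :
    IsOpenEmbedding (incl hU) := by
  refine ⟨IsEmbedding.inclusion (unitTangent_mono hU), ?_⟩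
  have : Set.range (incl hU) = (fun ζ : unitTangent disk => ζ.1.1) ⁻¹' U := by
    ext ζ
    constructor
    · rintro ⟨ξ, rfl⟩
      exact ξ.2.1
    · intro h
      exact ⟨⟨ζ.1, h, ζ.2.2⟩, rfl⟩
  rw [this]
  exact hU'.preimage (by fun_prop)

lemma isTest_extend {U : Set ℂ} (hU : U ⊆ disk) (hU' : IsOpen U) {f : unitTangent U → ℝ}
    (hf : Continuous f) (hs : HasCompactSupport f) :
    IsTest U (Function.extend (incl hU) f 0) := by
  have hi := isOpenEmbedding_incl hU hU'
  have hsub := hs.tsupport_extend_zero_subset hi.continuous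
  refine ⟨continuous_of_tsupport fun ζ hζ => ?_, hs.extend_zero hi.continuous, fun ζ hζ => ?_⟩
  · obtain ⟨ξ, -, rfl⟩ := hsub hζ
    rw [← hi.continuousAt_iff, Function.extend_comp hi.injective]
    exact hf.continuousAt
  · obtain ⟨ξ, -, rfl⟩ := hsub hζ
    exact ξ.2.1

/-- The support of `f` projects to a compact set in the `(x, t)` plane that does not depend on `θ`;
its area times a bound for `f` serves for all orbits. -/
lemma exists_orbitLIntegral_le {f : unitTangent disk → ℝ} (hf : Continuous f)
    (hs : HasCompactSupport f) :
    ∃ C : ℝ≥0∞, C ≠ ∞ ∧ ∀ θ, orbitLIntegral (fun ζ => ENNReal.ofReal (f ζ)) θ ≤ C := by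
  obtain ⟨M, hM⟩ := hf.bounded_above_of_compact_support hs
  let pr : unitTangent disk → ℝ × ℝ := fun ζ => (abscissa ζ, height ζ)
  have hpr : Continuous pr := continuous_abscissa.prodMk continuous_height
  have hK : IsCompact (pr '' tsupport f) := IsCompact.image hs hpr
  refine ⟨ENNReal.ofReal M * volume (pr '' tsupport f),
    ENNReal.mul_ne_top ENNReal.ofReal_ne_top hK.measure_lt_top.ne, fun θ => ?_⟩
  rw [orbitLIntegral, ← lintegral_indicator_const hK.measurableSet]
  refine lintegral_mono fun p => ?_
  by_cases hp : p ∈ pr '' tsupport f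
  · rw [Set.indicator_of_mem hp]
    exact ENNReal.ofReal_le_ofReal ((Real.le_norm_self _).trans (hM _))
  · have h0 : f (orbitPt p.1 p.2 θ) = 0 := by
      by_contra h
      refine hp ⟨_, subset_tsupport f h, ?_⟩
      simp only [pr, abscissa_orbitPt, height_orbitPt]
    simp only [h0, ENNReal.ofReal_zero]
    exact zero_le

/-- A bump function on the base, lifted to the unit tangent bundle. -/
noncomputable def bump (c : ℂ) (r : ℝ) (ζ : unitTangent disk) : ℝ := max 0 (r / 2 - ‖ζ.1.1 - c‖)

lemma isTest_bump {c : ℂ} {r : ℝ} (hr : 0 < r) (hU : Metric.ball c r ⊆ disk) :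
    IsTest (Metric.ball c r) (bump c r) := by
  have hsub : tsupport (bump c r) ⊆ {ζ | ζ.1.1 ∈ Metric.closedBall c (r / 2)} := by
    refine closure_minimal (fun ζ hζ => ?_)
      (Metric.isClosed_closedBall.preimage (by fun_prop : Continuous fun ζ : unitTangent disk =>
        ζ.1.1))
    rw [Set.mem_ofPred_eq, mem_closedBall_iff_norm]
    by_contra! h
    exact hζ (max_eq_left (by linarith))
  have hball : Metric.closedBall c (r / 2) ⊆ Metric.ball c r :=
    Metric.closedBall_subset_ball (by linarith)
  refine ⟨by unfold bump; fun_prop, ?_, fun ζ hζ => hball (hsub hζ)⟩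
  have hK : IsCompact ((↑) ⁻¹' Metric.closedBall c (r / 2) : Set disk) :=
    Topology.IsInducing.subtypeVal.isCompact_preimage' (isCompact_closedBall _ _)
      (by rw [Subtype.range_coe]; exact hball.trans hU)
  refine IsCompact.of_isClosed_subset
    ((hK.prod (isCompact_univ (X := circle))).image (continuous_toward Set.Subset.rfl))
    (isClosed_tsupport _) fun ζ hζ => ?_
  exact ⟨(⟨ζ.1.1, ζ.2.1⟩, endpoint ζ), ⟨hsub hζ, trivial⟩, toward_endpoint ζ⟩

lemma le_poissonKernel {z : ℂ} (hz : z ∈ disk) (θ : circle) :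
    (1 - ‖z‖ ^ 2) / 4 ≤ poissonKernel 0 z θ := by
  have h := norm_pos_iff.2 (circle_sub_ne_zero hz θ)
  have h1 : ‖(θ : ℂ) - z‖ ≤ 2 := by
    have := norm_sub_le (θ : ℂ) z
    rw [norm_circle] at this
    linarith [mem_disk.1 hz]
  rw [poissonKernel, sub_zero, sub_zero, norm_circle, one_pow]
  exact div_le_div_of_nonneg_left (norm_sq_lt_one hz).le (by positivity) (by nlinarith)

/-- The Poisson kernel is at least `(1 - |z|²) / 4` for every `θ`. Replacing it by this bound gives
a positive constant independent of the orbit. -/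
lemma exists_le_orbitLIntegral_bump {c : ℂ} {r : ℝ} (hr : 0 < r) (hU : Metric.ball c r ⊆ disk) :
    ∃ ε : ℝ≥0∞, ε ≠ 0 ∧ ∀ θ, ε ≤ orbitLIntegral (fun ζ => ENNReal.ofReal (bump c r ζ)) θ := by
  have hb := isTest_bump hr hU
  have hU' : MeasurableSet (Metric.ball c r) := Metric.isOpen_ball.measurableSet
  let m : ℂ → ℝ≥0∞ := fun z => ENNReal.ofReal (max 0 (r / 2 - ‖z - c‖)) *
    ENNReal.ofReal ((1 - ‖z‖ ^ 2) / 4)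
  have hm : Measurable m := by fun_prop
  refine ⟨∫⁻ z : Metric.ball c r, m z ∂(area (Metric.ball c r)), ?_, fun θ => ?_⟩
  · rw [lintegral_area hU' _ hm]
    refine ne_of_gt ?_
    refine lt_of_lt_of_le ?_ (lintegral_mono_set
      (Metric.ball_subset_ball (by linarith : r / 2 ≤ r)))
    rw [setLIntegral_pos_iff (by fun_prop)]
    refine lt_of_lt_of_le (Metric.measure_ball_pos volume c (half_pos hr)) (measure_mono ?_)
    intro z hz
    refine ⟨?_, hz⟩
    have hd := norm_sq_lt_one (hU (Metric.ball_subset_ball (by linarith : r / 2 ≤ r) hz))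
    have hz' : 0 < r / 2 - ‖z - c‖ := by
      rw [mem_ball_iff_norm] at hz; linarith
    have h1 : 0 < max 0 (r / 2 - ‖z - c‖) := lt_max_of_lt_right hz'
    have h2 : 0 < 4 / (1 - ‖z‖ ^ 2) ^ 2 := by positivity
    exact mul_ne_zero (ENNReal.ofReal_pos.2 h2).ne'
      (mul_ne_zero (ENNReal.ofReal_pos.2 h1).ne' (ENNReal.ofReal_pos.2 (by linarith)).ne')
  · rw [orbitLIntegral_eq hU hU' hb.continuous.measurable.ennreal_ofReal fun ζ hζ => by
      rw [image_eq_zero_of_notMem_tsupport fun h => hζ (hb.tsupport_subset h),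
        ENNReal.ofReal_zero]]
    refine lintegral_mono fun z => ?_
    exact mul_le_mul_right (ENNReal.ofReal_le_ofReal (le_poissonKernel (hU z.2) θ)) _

/-! ### Existence of the measure on the circle -/

/-- With `b` the bump function and `H` its orbit integral, the symmetry reads `∫ f H dν = ∫ b · O(f)
dν`. The right side depends on `b ν` only through its image `ψ` on the circle, so `H ν` is the
Poisson measure of `ψ`. Dividing by `H` gives `φ = H⁻¹ ψ`, which is finite because `H` is bounded
below. -/
theorem exists_measure_circle {c : ℂ} {r : ℝ} (hr : 0 < r) (hU : Metric.ball c r ⊆ disk)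
    {ν : Measure (unitTangent (Metric.ball c r))} [IsFiniteMeasure ν]
    (hν : InvariantSmall hU ν) :
    ∃ φ : Measure circle, IsFiniteMeasure φ ∧
      ∀ F : unitTangent (Metric.ball c r) → ℝ≥0∞, Measurable F →
        ∫⁻ ζ, F ζ ∂ν = poissonLIntegral φ fun z θ => F (toward hU z θ) := by
  have hUo : IsOpen (Metric.ball c r) := Metric.isOpen_ball
  have hU' := hUo.measurableSet
  have hb := isTest_bump hr hU
  have hb0 : 0 ≤ bump c r := fun ζ => le_max_left _ _
  have hi := (continuous_incl hU).measurable
  have he := continuous_endpoint.measurable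
  let b : unitTangent disk → ℝ≥0∞ := fun ζ => ENNReal.ofReal (bump c r ζ)
  have hbm : Measurable b := hb.continuous.measurable.ennreal_ofReal
  let H : circle → ℝ≥0∞ := orbitLIntegral b
  have hH : Measurable H := measurable_orbitLIntegral hbm
  obtain ⟨C, hC, hHC⟩ := exists_orbitLIntegral_le hb.continuous hb.hasCompactSupport
  obtain ⟨ε, hε, hHε⟩ := exists_le_orbitLIntegral_bump hr hU
  have hH0 : ∀ θ, H θ ≠ 0 := fun θ h => hε (le_antisymm (h ▸ hHε θ) zero_le)
  have hHt : ∀ θ, H θ ≠ ∞ := fun θ => ne_top_of_le_ne_top hC (hHC θ)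
  have hei : Measurable fun ζ => endpoint (incl hU ζ) := he.comp hi
  have hbi : Measurable fun ζ => b (incl hU ζ) := hbm.comp hi
  have hHi : Measurable fun ζ => H (endpoint (incl hU ζ)) := hH.comp hei
  let ψ : Measure circle :=
    (ν.withDensity fun ζ => b (incl hU ζ)).map fun ζ => endpoint (incl hU ζ)
  have hψ : ∀ u : circle → ℝ≥0∞, Measurable u →
      ∫⁻ θ, u θ ∂ψ = ∫⁻ ζ, b (incl hU ζ) * u (endpoint (incl hU ζ)) ∂ν := fun u hu => by
    rw [lintegral_map hu hei, lintegral_withDensity_eq_lintegral_mul _ hbi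
      (show Measurable fun ζ => u (endpoint (incl hU ζ)) from hu.comp hei)]
    rfl
  have hψf : IsFiniteMeasure ψ := by
    have : IsFiniteMeasure (ν.withDensity fun ζ => b (incl hU ζ)) := by
      refine isFiniteMeasure_withDensity (ne_top_of_le_ne_top
        (ENNReal.mul_ne_top (ENNReal.ofReal_ne_top (r := r / 2)) (measure_ne_top ν Set.univ)) ?_)
      rw [← lintegral_const]
      refine lintegral_mono fun ζ => ENNReal.ofReal_le_ofReal (max_le (by linarith) ?_)
      linarith [norm_nonneg ((incl hU ζ).1.1 - c)]
    infer_instance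
  have hloc : LocallyCompactSpace (unitTangent (Metric.ball c r)) :=
    (isOpenEmbedding_incl hU hUo).locallyCompactSpace
  have hfin : IsFiniteMeasure (ν.withDensity fun ζ => H (endpoint (incl hU ζ))) := by
    refine isFiniteMeasure_withDensity (ne_top_of_le_ne_top
      (ENNReal.mul_ne_top hC (measure_ne_top ν Set.univ)) ?_)
    rw [← lintegral_const]
    exact lintegral_mono fun ζ => hHC _
  have hM : (ν.withDensity fun ζ => H (endpoint (incl hU ζ))) = poissonMeasure hU ψ := by
    refine measure_eq_of_lintegral_eq fun f hf hs hf0 => ?_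
    have hft := isTest_extend hU hUo hf hs
    have hinj := (isOpenEmbedding_incl hU hUo).injective
    have hfe : ∀ ζ, Function.extend (incl hU) f 0 (incl hU ζ) = f ζ := fun ζ =>
      hinj.extend_apply _ _ ζ
    have hft0 : 0 ≤ Function.extend (incl hU) f 0 := fun ζ => by
      by_cases h : ∃ ξ, incl hU ξ = ζ
      · obtain ⟨ξ, rfl⟩ := h
        rw [hfe]; exact hf0 ξ
      · rw [Function.extend_apply' _ _ _ h]
    have hcomm := lintegral_mul_orbitLIntegral_comm hU hν hft hft0 hb hb0
    have hfm := hft.continuous.measurable.ennreal_ofReal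
    rw [lintegral_withDensity_eq_lintegral_mul _ hHi hf.measurable.ennreal_ofReal,
      lintegral_poissonMeasure hU hU' ψ hf.measurable.ennreal_ofReal, poissonLIntegral]
    have horb := orbitLIntegral_eq hU hU' hfm fun ζ hζ => by
      rw [image_eq_zero_of_notMem_tsupport fun h => hζ (hft.tsupport_subset h),
        ENNReal.ofReal_zero]
    simp_rw [hfe] at horb hcomm
    rw [← lintegral_congr horb, hψ _ (measurable_orbitLIntegral hfm), ← hcomm]
    exact lintegral_congr fun ζ => mul_comm _ _
  have hend : ∀ z θ, endpoint (incl hU (toward hU z θ)) = θ := fun z θ =>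
    endpoint_toward ⟨z, hU z.2⟩ θ
  have hformula : ∀ F : unitTangent (Metric.ball c r) → ℝ≥0∞, Measurable F →
      ∫⁻ ζ, F ζ ∂ν = poissonLIntegral (ψ.withDensity fun θ => (H θ)⁻¹)
        fun z θ => F (toward hU z θ) := fun F hF => by
    have hF' : Measurable fun ζ => (H (endpoint (incl hU ζ)))⁻¹ * F ζ := hHi.inv.mul hF
    have h1 := congrArg (fun M : Measure _ =>
      ∫⁻ ζ, (H (endpoint (incl hU ζ)))⁻¹ * F ζ ∂M) hM
    beta_reduce at h1
    rw [lintegral_withDensity_eq_lintegral_mul _ hHi hF',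
      lintegral_poissonMeasure hU hU' ψ hF'] at h1
    simp_rw [hend] at h1
    rw [poissonLIntegral_withDensity (w := fun θ => (H θ)⁻¹) hU hU' ψ hH.inv
      (hF.comp ((continuous_toward hU).comp continuous_swap).measurable), ← h1]
    refine lintegral_congr fun ζ => ?_
    simp only [Pi.mul_apply]
    rw [← mul_assoc, ENNReal.mul_inv_cancel (hH0 _) (hHt _), one_mul]
  refine ⟨ψ.withDensity fun θ => (H θ)⁻¹, ?_, hformula⟩
  refine isFiniteMeasure_withDensity (ne_top_of_le_ne_top
    (ENNReal.mul_ne_top (ENNReal.inv_ne_top.2 hε) (measure_ne_top ψ Set.univ)) ?_)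
  rw [← lintegral_const]
  exact lintegral_mono fun θ => ENNReal.inv_le_inv.2 (hHε θ)

/-! ### A measure on the circle is determined by its Poisson integral -/

lemma integrable_circle {E : Type*} [NormedAddCommGroup E] (φ : Measure circle)
    [IsFiniteMeasure φ] {f : circle → E} (hf : Continuous f) : Integrable f φ :=
  hf.integrable_of_hasCompactSupport (HasCompactSupport.of_compactSpace f)

/-- Conjugation supplies the moments of opposite sign, and `θ θ̄ = 1` reduces every monomial in `θ`
and `θ̄` to a power of one of them. The coordinate function generates a point-separating star
subalgebra, spanned by these monomials. -/
lemma circle_measure_ext {φ φ' : Measure circle} [IsFiniteMeasure φ] [IsFiniteMeasure φ']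
    (h : ∀ n : ℕ, ∫ θ, conj (θ : ℂ) ^ n ∂φ = ∫ θ, conj (θ : ℂ) ^ n ∂φ') : φ = φ' := by
  have h' : ∀ n : ℕ, ∫ θ, (θ : ℂ) ^ n ∂φ = ∫ θ, (θ : ℂ) ^ n ∂φ' := fun n => by
    have h1 := congrArg conj (h n)
    rw [← integral_conj, ← integral_conj] at h1
    simpa using h1
  have hmn : ∀ n m : ℕ, ∫ θ, (θ : ℂ) ^ n * conj (θ : ℂ) ^ m ∂φ =
      ∫ θ, (θ : ℂ) ^ n * conj (θ : ℂ) ^ m ∂φ' := fun n m => by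
    rcases le_total m n with hle | hle
    · obtain ⟨k, rfl⟩ := Nat.exists_eq_add_of_le hle
      have e : ∀ θ : circle, (θ : ℂ) ^ (m + k) * conj (θ : ℂ) ^ m = (θ : ℂ) ^ k := fun θ => by
        rw [pow_add, mul_right_comm, ← mul_pow, circle_mul_conj, one_pow, one_mul]
      simp_rw [e, h']
    · obtain ⟨k, rfl⟩ := Nat.exists_eq_add_of_le hle
      have e : ∀ θ : circle, (θ : ℂ) ^ n * conj (θ : ℂ) ^ (n + k) = conj (θ : ℂ) ^ k := fun θ => by
        rw [pow_add, ← mul_assoc, ← mul_pow, circle_mul_conj, one_pow, one_mul]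
      simp_rw [e, h]
  let X : BoundedContinuousFunction circle ℂ :=
    BoundedContinuousFunction.mkOfCompact ⟨fun θ => (θ : ℂ), continuous_subtype_val⟩
  refine ext_of_forall_mem_subalgebra_integral_eq_of_pseudoEMetric_complete_countable
    (𝕜 := ℂ) (A := StarAlgebra.adjoin ℂ {X}) ?_ fun g hg => ?_
  · intro x y hxy
    refine ⟨fun θ => (θ : ℂ), ⟨⟨fun θ => (θ : ℂ), continuous_subtype_val⟩, ?_, rfl⟩,
      fun h => hxy (Subtype.ext h)⟩
    exact ⟨X, StarAlgebra.self_mem_adjoin_singleton ℂ X, rfl⟩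
  · have hg' : g ∈ Submodule.span ℂ (Submonoid.closure ({X} ∪ star {X}) :
        Set (BoundedContinuousFunction circle ℂ)) := by
      rw [← StarAlgebra.adjoin_eq_span]; exact hg
    induction hg' using Submodule.span_induction with
    | mem x hx =>
      have hx' : ∃ n m : ℕ, ∀ θ, x θ = (θ : ℂ) ^ n * conj (θ : ℂ) ^ m := by
        clear hg
        induction hx using Submonoid.closure_induction with
        | mem x hx =>
          rcases hx with hx | hx
          · rw [Set.mem_singleton_iff] at hx
            exact ⟨1, 0, fun θ => by simp [hx, X]⟩
          · rw [Set.star_singleton, Set.mem_singleton_iff] at hx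
            exact ⟨0, 1, fun θ => by simp [hx, X]⟩
        | one => exact ⟨0, 0, fun θ => by simp⟩
        | mul x y _ _ hx hy =>
          obtain ⟨n, m, hx⟩ := hx
          obtain ⟨n', m', hy⟩ := hy
          exact ⟨n + n', m + m', fun θ => by
            rw [BoundedContinuousFunction.mul_apply, hx, hy]; ring⟩
      obtain ⟨n, m, hx'⟩ := hx'
      simp_rw [hx', hmn]
    | zero => simp
    | add x y hx hy hx' hy' =>
      have hm : ∀ x ∈ Submodule.span ℂ (Submonoid.closure ({X} ∪ star {X}) :
          Set (BoundedContinuousFunction circle ℂ)), x ∈ StarAlgebra.adjoin ℂ {X} := fun x hx => by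
        rw [← StarAlgebra.adjoin_eq_span] at hx; exact hx
      simp only [BoundedContinuousFunction.add_apply]
      rw [integral_add (x.integrable _) (y.integrable _), integral_add (x.integrable _)
        (y.integrable _), hx' (hm x hx), hy' (hm y hy)]
    | smul a x hx hx' =>
      have hm : ∀ x ∈ Submodule.span ℂ (Submonoid.closure ({X} ∪ star {X}) :
          Set (BoundedContinuousFunction circle ℂ)), x ∈ StarAlgebra.adjoin ℂ {X} := fun x hx => by
        rw [← StarAlgebra.adjoin_eq_span] at hx; exact hx
      simp only [BoundedContinuousFunction.coe_smul]
      rw [integral_smul, integral_smul, hx' (hm x hx)]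

/-! ### Moments and the power series of a Poisson integral. -/

lemma norm_conj_mul_lt_one {z : ℂ} (hz : z ∈ disk) (θ : circle) : ‖conj (θ : ℂ) * z‖ < 1 := by
  rw [norm_mul, RCLike.norm_conj, norm_circle, one_mul]
  exact mem_disk.1 hz

lemma poissonKernel_eq_re {z : ℂ} (hz : z ∈ disk) (θ : circle) :
    poissonKernel 0 z θ = -1 + 2 * ((1 - conj (θ : ℂ) * z)⁻¹).re := by
  have h := circle_sub_ne_zero hz θ
  have hθ := circle_ne_zero θ
  have h1 : (1 - conj (θ : ℂ) * z)⁻¹ = θ / (θ - z) := by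
    rw [← Complex.inv_eq_conj (norm_circle θ)]
    field_simp
  have h2 : ((θ : ℂ) + z) / (θ - z) = -1 + (2 : ℝ) * ((θ : ℂ) / (θ - z)) := by
    field_simp
    push_cast
    ring
  rw [poissonKernel_eq_re_herglotzRieszKernel, Function.comp_apply, herglotzRieszKernel, sub_zero,
    sub_zero, h1, h2, add_re, re_ofReal_mul]
  simp

/-- The moments of a measure on the circle. -/
noncomputable def moment (φ : Measure circle) (n : ℕ) : ℂ := ∫ θ, conj (θ : ℂ) ^ n ∂φ

lemma moment_zero (φ : Measure circle) : moment φ 0 = (φ.real Set.univ : ℂ) := by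
  simp [moment]

lemma norm_moment_le (φ : Measure circle) [IsFiniteMeasure φ] (n : ℕ) :
    ‖moment φ n‖ ≤ φ.real Set.univ := by
  have h := norm_integral_le_of_norm_le_const (μ := φ) (f := fun θ => conj (θ : ℂ) ^ n) (C := 1)
    (Eventually.of_forall fun θ => by
      rw [norm_pow, RCLike.norm_conj, norm_circle, one_pow])
  rwa [one_mul] at h

/-- Expand the Cauchy kernel as a geometric series in `θ̄ z`, dominated by `‖z‖ ^ n`, and integrate
term by term. -/
lemma hasSum_moment (φ : Measure circle) [IsFiniteMeasure φ] {z : ℂ} (hz : z ∈ disk) :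
    HasSum (fun n => moment φ n * z ^ n) (∫ θ, (1 - conj (θ : ℂ) * z)⁻¹ ∂φ) := by
  have hn : ∀ (n : ℕ) (θ : circle), ‖(conj (θ : ℂ) * z) ^ n‖ = ‖z‖ ^ n := fun n θ => by
    rw [norm_pow, norm_mul, RCLike.norm_conj, norm_circle, one_mul]
  have h := hasSum_integral_of_summable_integral_norm (μ := φ)
    (F := fun (n : ℕ) (θ : circle) => (conj (θ : ℂ) * z) ^ n)
    (fun n => integrable_circle φ (by fun_prop)) (by
      simp_rw [hn, integral_const, smul_eq_mul]
      exact (summable_geometric_of_lt_one (norm_nonneg z) (mem_disk.1 hz)).mul_left _)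
  have h1 : ∀ θ : circle, ∑' n : ℕ, (conj (θ : ℂ) * z) ^ n = (1 - conj (θ : ℂ) * z)⁻¹ := fun θ =>
    tsum_geometric_of_norm_lt_one (norm_conj_mul_lt_one hz θ)
  simp_rw [h1, mul_pow, integral_mul_const] at h
  exact h

lemma continuous_inv_one_sub {z : ℂ} (hz : z ∈ disk) :
    Continuous fun θ : circle => (1 - conj (θ : ℂ) * z)⁻¹ := by
  refine Continuous.inv₀ (by fun_prop) fun θ h => ?_
  have h1 := norm_conj_mul_lt_one hz θ
  rw [← sub_eq_zero.1 h, norm_one] at h1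
  exact lt_irrefl _ h1

lemma integral_poissonKernel (φ : Measure circle) [IsFiniteMeasure φ] {z : ℂ} (hz : z ∈ disk) :
    ∫ θ : circle, poissonKernel 0 z θ ∂φ =
      -φ.real Set.univ + 2 * (∑' n, moment φ n * z ^ n).re := by
  have hi := integrable_circle φ (continuous_inv_one_sub hz)
  simp_rw [poissonKernel_eq_re hz]
  have hi' : Integrable (fun θ : circle => 2 * ((1 - conj (θ : ℂ) * z)⁻¹).re) φ :=
    (integrable_circle φ (continuous_re.comp (continuous_inv_one_sub hz))).const_mul 2
  rw [integral_add (integrable_const _) hi', integral_const,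
    integral_const_mul, (hasSum_moment φ hz).tsum_eq]
  have h := integral_re hi
  simp only [RCLike.re_eq_complex_re] at h
  rw [h]
  simp

/-- The power series whose coefficients are the differences of the moments of two measures. -/
noncomputable def momentSeries (φ φ' : Measure circle) : FormalMultilinearSeries ℂ ℂ ℂ :=
  FormalMultilinearSeries.ofScalars ℂ fun n => moment φ n - moment φ' n

lemma hasFPowerSeriesOnBall_moment (φ φ' : Measure circle) [IsFiniteMeasure φ]
    [IsFiniteMeasure φ'] :
    HasFPowerSeriesOnBall (momentSeries φ φ').sum (momentSeries φ φ') 0 1 := by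
  have h1 : (1 : ℝ≥0∞) ≤ (momentSeries φ φ').radius := by
    have := (momentSeries φ φ').le_radius_of_bound (r := 1)
      (φ.real Set.univ + φ'.real Set.univ) fun n => by
        rw [momentSeries, FormalMultilinearSeries.ofScalars_norm, NNReal.coe_one, one_pow, mul_one]
        exact (norm_sub_le _ _).trans (add_le_add (norm_moment_le φ n) (norm_moment_le φ' n))
    simpa using this
  exact ((momentSeries φ φ').hasFPowerSeriesOnBall (lt_of_lt_of_le one_pos h1)).mono one_pos h1

lemma momentSeries_sum (φ φ' : Measure circle) [IsFiniteMeasure φ] [IsFiniteMeasure φ'] {z : ℂ}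
    (hz : z ∈ disk) : (momentSeries φ φ').sum z =
      ∑' n, moment φ n * z ^ n - ∑' n, moment φ' n * z ^ n := by
  change FormalMultilinearSeries.ofScalarsSum (fun n => moment φ n - moment φ' n) z = _
  rw [FormalMultilinearSeries.ofScalars_sum_eq,
    ← (hasSum_moment φ hz).summable.tsum_sub (hasSum_moment φ' hz).summable]
  exact tsum_congr fun n => by rw [smul_eq_mul, sub_mul]

/-- The two Poisson integrals agree on `U` exactly when the difference `D` of the moment series has
constant real part there, namely half the difference `M` of the total masses. Then `D` is constant
on `U`, hence on `𝔻`, and its coefficients can be compared. -/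
theorem circle_measure_eq_of_integral_poissonKernel {φ φ' : Measure circle} [IsFiniteMeasure φ]
    [IsFiniteMeasure φ'] {U : Set ℂ} (hU : U ⊆ disk) (hUo : IsOpen U) (hUc : IsPreconnected U)
    (hUn : U.Nonempty)
    (h : ∀ z ∈ U, ∫ θ : circle, poissonKernel 0 z θ ∂φ = ∫ θ : circle, poissonKernel 0 z θ ∂φ') :
    φ = φ' := by
  set D := (momentSeries φ φ').sum with hD
  have hp := hasFPowerSeriesOnBall_moment φ φ'
  have hball : Metric.eball (0 : ℂ) 1 = disk := by
    rw [disk, ← Metric.eball_ofReal]; simp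
  have hDa : AnalyticOnNhd ℂ D disk := hball ▸ hp.analyticOnNhd
  set M := φ.real Set.univ - φ'.real Set.univ with hM
  have hre : ∀ z ∈ U, (D z).re = M / 2 := fun z hz => by
    have h1 := h z hz
    rw [integral_poissonKernel φ (hU hz), integral_poissonKernel φ' (hU hz)] at h1
    rw [hD, momentSeries_sum φ φ' (hU hz), sub_re, hM]
    linarith
  -- Otherwise `D` would be an open map on `U`, and so would its real part, whose image is a single
  -- point.
  obtain ⟨w, hw⟩ : ∃ w, ∀ z ∈ U, D z = w := by
    rcases (hDa.mono hU).is_constant_or_isOpen hUc with h1 | h1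
    · exact h1
    · exfalso
      have h2 := h1 U subset_rfl hUo
      have h3 := isOpenMap_re _ h2
      have h4 : re '' (D '' U) = {M / 2} := by
        rw [Set.image_image]
        ext y
        constructor
        · rintro ⟨z, hz, rfl⟩
          exact hre z hz
        · rintro rfl
          obtain ⟨z, hz⟩ := hUn
          exact ⟨z, hz, hre z hz⟩
      rw [h4] at h3
      exact not_isOpen_singleton _ h3
  obtain ⟨z₀, hz₀⟩ := hUn
  have hconst : Set.EqOn D (fun _ => w) disk :=
    hDa.eqOn_of_preconnected_of_eventuallyEq analyticOnNhd_const
      (convex_ball (0 : ℂ) 1).isPreconnected (hU hz₀)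
      (by filter_upwards [hUo.mem_nhds hz₀] with z hz using hw z hz)
  have h0 : (0 : ℂ) ∈ disk := by simp [disk]
  have hps : momentSeries φ φ' = constFormalMultilinearSeries ℂ ℂ w := by
    refine hp.hasFPowerSeriesAt.eq_formalMultilinearSeries_of_eventually
      hasFPowerSeriesAt_const ?_
    filter_upwards [Metric.isOpen_ball.mem_nhds h0] with z hz using hconst hz
  have hcoeff : ∀ n, moment φ n - moment φ' n = (constFormalMultilinearSeries ℂ ℂ w).coeff n :=
    fun n => by
      rw [← hps, momentSeries, FormalMultilinearSeries.coeff_ofScalars]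
  -- The constant coefficient of `D` is `M`, while its real part is `M / 2`; hence `M = 0`.
  have hm0 : moment φ 0 = moment φ' 0 := by
    have h1 : moment φ 0 - moment φ' 0 = w := by
      rw [hcoeff]; simp [FormalMultilinearSeries.coeff]
    have h2 : w.re = M / 2 := by rw [← hw z₀ hz₀]; exact hre z₀ hz₀
    have h3 : moment φ 0 - moment φ' 0 = (M : ℂ) := by
      rw [moment_zero, moment_zero, hM]; push_cast; rfl
    have h4 : M = M / 2 := by
      rw [← h2, ← h1, h3, ofReal_re]
    have h5 : M = 0 := by linarith
    rw [h5] at h3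
    exact sub_eq_zero.1 (by simpa using h3)
  refine circle_measure_ext fun n => ?_
  rcases n.eq_zero_or_pos with rfl | hn
  · exact hm0
  · have h1 := hcoeff n
    rw [FormalMultilinearSeries.coeff,
      constFormalMultilinearSeries_apply_of_nonzero hn.ne'] at h1
    rw [zero_apply] at h1
    exact sub_eq_zero.1 h1

/-! ### Poisson integrals as densities with respect to hyperbolic area. -/

lemma isOpenPosMeasure_area {U : Set ℂ} (hU : U ⊆ disk) (hUo : IsOpen U) :
    (area U).IsOpenPosMeasure := by
  refine ⟨fun V hV hVn h0 => ?_⟩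
  have hW : IsOpen ((↑) '' V : Set ℂ) := hUo.isOpenMap_subtype_val V hV
  have h1 : area U V = ∫⁻ z : U, ((↑) '' V : Set ℂ).indicator 1 (z : ℂ) ∂(area U) := by
    rw [← lintegral_indicator_one hV.measurableSet]
    refine lintegral_congr fun z => ?_
    by_cases hz : z ∈ V
    · rw [Set.indicator_of_mem hz, Set.indicator_of_mem (Set.mem_image_of_mem _ hz)]
      rfl
    · rw [Set.indicator_of_notMem hz, Set.indicator_of_notMem]
      rintro ⟨y, hy, hyz⟩
      exact hz (Subtype.ext hyz ▸ hy)
  have hm : Measurable (((↑) '' V : Set ℂ).indicator (1 : ℂ → ℝ≥0∞)) :=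
    measurable_one.indicator hW.measurableSet
  rw [h0, lintegral_area hUo.measurableSet _ hm] at h1
  refine h1.not_lt ?_
  have hdm : Measurable fun z : ℂ => ENNReal.ofReal (4 / (1 - ‖z‖ ^ 2) ^ 2) *
      ((↑) '' V : Set ℂ).indicator 1 z := Measurable.mul (by fun_prop) hm
  rw [setLIntegral_pos_iff hdm]
  refine lt_of_lt_of_le (hW.measure_pos volume (hVn.image _)) (measure_mono ?_)
  rintro _ ⟨z, hz, rfl⟩
  refine ⟨?_, z.2⟩
  have hd := norm_sq_lt_one (hU z.2)
  have h2 : 0 < 4 / (1 - ‖(z : ℂ)‖ ^ 2) ^ 2 := by positivity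
  rw [Function.mem_support, Set.indicator_of_mem (Set.mem_image_of_mem _ hz)]
  exact mul_ne_zero (ENNReal.ofReal_pos.2 h2).ne' one_ne_zero

lemma continuous_poissonKernel_right {z : ℂ} (hz : z ∈ disk) :
    Continuous fun θ : circle => poissonKernel 0 z (θ : ℂ) := by
  unfold poissonKernel
  refine Continuous.div (by fun_prop) (by fun_prop) fun θ => ?_
  rw [sub_zero, sub_zero]
  exact pow_ne_zero _ (norm_ne_zero_iff.2 (circle_sub_ne_zero hz θ))

/-- The Poisson integral of a measure on the circle. -/
noncomputable def poissonIntegral (φ : Measure circle) (z : ℂ) : ℝ :=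
  ∫ θ : circle, poissonKernel 0 z θ ∂φ

lemma poissonIntegral_nonneg (φ : Measure circle) {z : ℂ} (hz : z ∈ disk) :
    0 ≤ poissonIntegral φ z :=
  integral_nonneg fun θ => (poissonKernel_pos hz θ).le

lemma continuous_poissonIntegral (φ : Measure circle) [IsFiniteMeasure φ] {U : Set ℂ}
    (hU : U ⊆ disk) (hUo : IsOpen U) : Continuous fun z : U => poissonIntegral φ z := by
  have := hUo.locallyCompactSpace
  have h := continuous_parametric_integral_of_continuous (μ := φ) (f := fun (z : U) (θ : circle) =>
    poissonKernel 0 (z : ℂ) (θ : ℂ)) (continuous_poissonKernel hU) isCompact_univ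
  simp_rw [Measure.restrict_univ] at h
  exact h

lemma poissonLIntegral_eq_lintegral (φ : Measure circle) [IsFiniteMeasure φ] {U : Set ℂ}
    (hU : U ⊆ disk) (hUo : IsOpen U) {G : U → ℝ≥0∞} (hG : Measurable G) :
    poissonLIntegral φ (fun z _ => G z) =
      ∫⁻ z, G z ∂((area U).withDensity fun z => ENNReal.ofReal (poissonIntegral φ z)) := by
  have := sigmaFinite_area hUo.measurableSet
  have hkm := measurable_ofReal_poissonKernel hU
  have hGk : Measurable fun p : circle × U => G p.2 *
      ENNReal.ofReal (poissonKernel 0 (p.2 : ℂ) (p.1 : ℂ)) := (hG.comp measurable_snd).mul hkm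
  rw [lintegral_withDensity_eq_lintegral_mul _
      (continuous_poissonIntegral φ hU hUo).measurable.ennreal_ofReal hG,
    poissonLIntegral, lintegral_lintegral_swap (f := fun (θ : circle) (z : U) => G z *
      ENNReal.ofReal (poissonKernel 0 (z : ℂ) (θ : ℂ))) hGk.aemeasurable]
  refine lintegral_congr fun z => ?_
  have hkz := continuous_poissonKernel_right (hU z.2)
  have h1 : ENNReal.ofReal (poissonIntegral φ z) =
      ∫⁻ θ : circle, ENNReal.ofReal (poissonKernel 0 (z : ℂ) (θ : ℂ)) ∂φ :=
    ofReal_integral_eq_lintegral_ofReal (integrable_circle φ hkz)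
      (Eventually.of_forall fun θ => (poissonKernel_pos (hU z.2) θ).le)
  have h2 := lintegral_const_mul (μ := φ) (G z) hkz.measurable.ennreal_ofReal
  rw [h2, Pi.mul_apply, h1]
  exact mul_comm _ _

/-- The hypothesis only gives equality of densities almost everywhere. Both are continuous and area
charges every nonempty open set, so they agree at each point of `U`. -/
theorem circle_measure_eq_of_poissonLIntegral {φ φ' : Measure circle} [IsFiniteMeasure φ]
    [IsFiniteMeasure φ'] {U : Set ℂ} (hU : U ⊆ disk) (hUo : IsOpen U) (hUc : IsPreconnected U)
    (hUn : U.Nonempty)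
    (h : ∀ G : U → ℝ≥0∞, Measurable G →
      poissonLIntegral φ (fun z _ => G z) = poissonLIntegral φ' fun z _ => G z) :
    φ = φ' := by
  have := sigmaFinite_area hUo.measurableSet
  have := isOpenPosMeasure_area hU hUo
  have hc := continuous_poissonIntegral φ hU hUo
  have hc' := continuous_poissonIntegral φ' hU hUo
  have hE : ((area U).withDensity fun z => ENNReal.ofReal (poissonIntegral φ z)) =
      (area U).withDensity fun z => ENNReal.ofReal (poissonIntegral φ' z) := by
    refine Measure.ext fun s hs => ?_
    have hm : Measurable (s.indicator (1 : U → ℝ≥0∞)) := measurable_one.indicator hs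
    rw [← lintegral_indicator_one hs, ← lintegral_indicator_one hs,
      ← poissonLIntegral_eq_lintegral φ hU hUo hm, ← poissonLIntegral_eq_lintegral φ' hU hUo hm]
    exact h _ hm
  rw [withDensity_eq_iff_of_sigmaFinite hc.measurable.ennreal_ofReal.aemeasurable
    hc'.measurable.ennreal_ofReal.aemeasurable] at hE
  have hE' := ((ENNReal.continuous_ofReal.comp hc).ae_eq_iff_eq (area U)
      (ENNReal.continuous_ofReal.comp hc')).1 hE
  refine circle_measure_eq_of_integral_poissonKernel hU hUo hUc hUn fun z hz => ?_
  exact (ENNReal.ofReal_eq_ofReal_iff (poissonIntegral_nonneg φ (hU hz))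
    (poissonIntegral_nonneg φ' (hU hz))).1 (congrFun hE' ⟨z, hz⟩)

lemma continuous_proj {U : Set ℂ} : Continuous (proj (U := U)) :=
  Continuous.subtype_mk (continuous_fst.comp continuous_subtype_val) _

end AffineLift

theorem proposition1 (c : ℂ) (r : ℝ) (hr : 0 < r) (hU : Metric.ball c r ⊆ AffineLift.disk)
    (μ : Measure (Metric.ball c r)) [IsProbabilityMeasure μ] :
    (∀ ν₁ ν₂ : Measure (AffineLift.unitTangent (Metric.ball c r)),
      AffineLift.InvariantSmall hU ν₁ → ν₁.map AffineLift.proj = μ →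
      AffineLift.InvariantSmall hU ν₂ → ν₂.map AffineLift.proj = μ → ν₁ = ν₂) ∧
    (∀ ν : Measure (AffineLift.unitTangent (Metric.ball c r)),
      AffineLift.InvariantSmall hU ν → ν.map AffineLift.proj = μ →
      ∃ φ : Measure AffineLift.circle, IsFiniteMeasure φ ∧
        (∀ F : AffineLift.unitTangent (Metric.ball c r) → ℝ≥0∞, Measurable F →
          ∫⁻ ζ, F ζ ∂ν =
            AffineLift.poissonLIntegral φ fun z θ => F (AffineLift.toward hU z θ)) ∧
        ∀ φ' : Measure AffineLift.circle, IsFiniteMeasure φ' →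
          (∀ G : Metric.ball c r → ℝ≥0∞, Measurable G →
            ∫⁻ z, G z ∂μ = AffineLift.poissonLIntegral φ' fun z _ => G z) →
          φ' = φ) := by
  have hproj : Measurable (AffineLift.proj (U := Metric.ball c r)) :=
    AffineLift.continuous_proj.measurable
  have hex : ∀ ν : Measure (AffineLift.unitTangent (Metric.ball c r)),
      AffineLift.InvariantSmall hU ν → ν.map AffineLift.proj = μ →
      ∃ φ : Measure AffineLift.circle, IsFiniteMeasure φ ∧
        (∀ F : AffineLift.unitTangent (Metric.ball c r) → ℝ≥0∞, Measurable F →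
          ∫⁻ ζ, F ζ ∂ν =
            AffineLift.poissonLIntegral φ fun z θ => F (AffineLift.toward hU z θ)) ∧
        ∀ G : Metric.ball c r → ℝ≥0∞, Measurable G →
          ∫⁻ z, G z ∂μ = AffineLift.poissonLIntegral φ fun z _ => G z := by
    intro ν hν hνμ
    -- Finiteness of `ν` is not assumed; its total mass is that of its projection `μ`.
    have : IsFiniteMeasure ν := by
      refine ⟨?_⟩
      have h := measure_lt_top μ Set.univ
      rwa [← hνμ, Measure.map_apply hproj MeasurableSet.univ, Set.preimage_univ] at h
    obtain ⟨φ, hφ, hF⟩ := AffineLift.exists_measure_circle hr hU hν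
    refine ⟨φ, hφ, hF, fun G hG => ?_⟩
    rw [← hνμ, lintegral_map hG hproj]
    exact hF _ (hG.comp hproj)
  have huniq : ∀ φ φ' : Measure AffineLift.circle, IsFiniteMeasure φ → IsFiniteMeasure φ' →
      (∀ G : Metric.ball c r → ℝ≥0∞, Measurable G →
        ∫⁻ z, G z ∂μ = AffineLift.poissonLIntegral φ fun z _ => G z) →
      (∀ G : Metric.ball c r → ℝ≥0∞, Measurable G →
        ∫⁻ z, G z ∂μ = AffineLift.poissonLIntegral φ' fun z _ => G z) → φ = φ' :=
    fun φ φ' _ _ h h' => AffineLift.circle_measure_eq_of_poissonLIntegral hU Metric.isOpen_ball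
      (convex_ball c r).isPreconnected ⟨c, Metric.mem_ball_self hr⟩
      fun G hG => (h G hG).symm.trans (h' G hG)
  refine ⟨fun ν₁ ν₂ h₁ hμ₁ h₂ hμ₂ => ?_, fun ν hν hνμ => ?_⟩
  · obtain ⟨φ₁, hφ₁, hF₁, hG₁⟩ := hex ν₁ h₁ hμ₁
    obtain ⟨φ₂, hφ₂, hF₂, hG₂⟩ := hex ν₂ h₂ hμ₂
    obtain rfl := huniq φ₁ φ₂ hφ₁ hφ₂ hG₁ hG₂
    refine Measure.ext fun s hs => ?_
    rw [← lintegral_indicator_one hs, ← lintegral_indicator_one hs,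
      hF₁ _ (measurable_one.indicator hs), hF₂ _ (measurable_one.indicator hs)]
  · obtain ⟨φ, hφ, hF, hG⟩ := hex ν hν hνμ
    exact ⟨φ, hφ, hF, fun φ' hφ' hG' => huniq φ' φ hφ' hφ hG' hG⟩
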